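/- Let $\mathbb D=\{z\in\mathbb C:|z|<1\}$ and let $\mathcal S$ be the family of univalent analytic functions $f$ on $\mathbb D$ with $f(0)=0$ and $f'(0)=1$. Let $\phi:\mathbb D\to\mathbb C$ be analytic and univalent with $\operatorname{Re}\phi>0$ on $\mathbb D$, $\phi(0)=1$, $\phi'(0)>0$, and with $\phi(\mathbb D)$ symmetric with respect to the real axis and starlike with respect to $1$. Write $\phi(z)=1+\sum_{n\ge1}B_nz^n$ and suppose that $B_n>0$ for all $n\ge1$ and that $\phi$ is in the Hardy class $H^2$ of $\mathbb D$. Let $\mathcal C(\phi)$ be the class of all $f\in\mathcal S$ with $1+zf''(z)/f'(z)\prec\phi(z)$, where $F\prec G$ means that $F=G\circ\omega$ on $\mathbb D$ for some analytic $\omega:\mathbb D\to\mathbb D$ with $\omega(0)=0$. Then there is a function $k\in\mathcal S$ with $1+zk''(z)/k'(z)=\phi(z)$ on $\mathbb D$, and for any such $k$ the following holds. The limit $k(-1):=\lim_{r\to1^-}k(-r)$ exists and is real, and the equation $k(r)+k(-1)=0$ has a smallest root $r_f$ in $(0,1)$. For every $f(z)=z+\sum_{n\ge2}a_nz^n$ in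 $\mathcal C(\phi)$ the series $\sum_{n\ge 2}|a_n||z|^n$ converges for $|z|<1$, and $$M_f(|z|):=|z|+\sum_{n=2}^{\infty}|a_n||z|^n\le d\bigl(f(0),\partial f(\mathbb D)\bigr)\qquad\text{for } |z|\le\min\{r_f,1/3\},$$ where $d$ is the Euclidean distance. If $r_f\le 1/3$, then the radius $r_f$ is best possible: each rotation $k_\theta(z)=e^{-i\theta}k(e^{i\theta}z)$, $\theta\in\mathbb R$, belongs to $\mathcal C(\phi)$ and satisfies $M_{k_\theta}(r_f)=d(k_\theta(0),\partial k_\theta(\mathbb D))=-k(-1)$, while $M_{k_\theta}(r)>d(k_\theta(0),\partial k_\theta(\mathbb D))$ for $r_f<r<1$. -/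

import Mathlib

open Set Filter Topology

namespace MaMinda

noncomputable section

/-- The open unit disk of the complex plane. Functions on the disk are represented by
functions `ℂ → ℂ` of which only the values on the disk are used. -/
def disk : Set ℂ := Metric.ball (0 : ℂ) 1

/-- The `n`-th Taylor coefficient at the origin, `a_n = f⁽ⁿ⁾(0) / n!`. -/
def coeff (f : ℂ → ℂ) (n : ℕ) : ℂ := iteratedDeriv n f 0 / (n.factorial : ℂ)

/-- The family `S`: analytic univalent functions on the disk with
`f 0 = 0` and `f' 0 = 1`. -/
structure IsUnivalentNormalized (f : ℂ → ℂ) : Prop where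
  analytic : DifferentiableOn ℂ f disk
  map_zero : f 0 = 0
  deriv_zero : deriv f 0 = 1
  univalent : InjOn f disk

/-- Subordination `F ≺ G`: there is an analytic self-map `ω` of the disk with `ω 0 = 0` and
`F = G ∘ ω` on the disk. -/
def Subordinate (F G : ℂ → ℂ) : Prop :=
  ∃ ω : ℂ → ℂ, DifferentiableOn ℂ ω disk ∧ MapsTo ω disk disk ∧ ω 0 = 0 ∧
    ∀ z ∈ disk, F z = G (ω z)

/-- Ma–Minda functions: analytic and univalent on the disk, with positive real part, the image
being symmetric in the real axis and starlike with respect to `φ 0 = 1`, and `φ' 0 > 0`. -/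
structure IsMaMinda (φ : ℂ → ℂ) : Prop where
  analytic : DifferentiableOn ℂ φ disk
  univalent : InjOn φ disk
  re_pos : ∀ z ∈ disk, 0 < (φ z).re
  symmetric : ∀ w ∈ φ '' disk, (starRingEnd ℂ) w ∈ φ '' disk
  map_zero : φ 0 = 1
  starlike : StarConvex ℝ (1 : ℂ) (φ '' disk)
  deriv_im : (deriv φ 0).im = 0
  deriv_pos : 0 < (deriv φ 0).re

/-- The Hardy class `H²` of the disk: analytic functions whose quadratic means over the circles
`|z| = r`, `0 ≤ r < 1`, are bounded. -/
def IsHardyTwo (f : ℂ → ℂ) : Prop :=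
  DifferentiableOn ℂ f disk ∧
    ∃ C : ℝ, ∀ r ∈ Ico (0 : ℝ) 1, Real.circleAverage (fun z => ‖f z‖ ^ 2) 0 r ≤ C

/-- `z ↦ 1 + z f''(z) / f'(z)`. For univalent `f` the derivative has no zero on the disk. -/
def convexityQuotient (f : ℂ → ℂ) (z : ℂ) : ℂ := 1 + z * deriv (deriv f) z / deriv f z

/-- The Ma–Minda convex class `C(φ)`. -/
def IsConvexClass (φ f : ℂ → ℂ) : Prop :=
  IsUnivalentNormalized f ∧ Subordinate (convexityQuotient f) φ

/-- `k ∈ S` is the extremal function of `C(φ)`: `1 + z k''(z) / k'(z) = φ(z)` on the disk. -/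
def IsConvexExtremal (φ k : ℂ → ℂ) : Prop :=
  IsUnivalentNormalized k ∧ ∀ z ∈ disk, convexityQuotient k z = φ z

/-- The rotation `z ↦ e^{-iθ} f(e^{iθ} z)`. -/
def rotation (θ : ℝ) (f : ℂ → ℂ) (z : ℂ) : ℂ :=
  Complex.exp (-(θ * Complex.I)) * f (Complex.exp (θ * Complex.I) * z)

/-- The majorant series `r + ∑_{n ≥ 2} |a_n| r^n` of `f(z) = z + ∑_{n ≥ 2} a_n z^n`. -/
def majorant (f : ℂ → ℂ) (r : ℝ) : ℝ := r + ∑' n : ℕ, ‖coeff f (n + 2)‖ * r ^ (n + 2)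

/-- The Euclidean distance `d(f(0), ∂f(𝔻))`. -/
def boundaryDist (f : ℂ → ℂ) : ℝ := Metric.infDist (f 0) (frontier (f '' disk))

end

end MaMinda

/-!
Write `f' = exp Q` for `f` in `C(φ)` and `k' = exp P`, so that `z Q' = φ ∘ ω - 1` and
`z P' = φ - 1`. The function `k` obtained by integrating `exp P` is univalent because the tangent of
`t ↦ k (R exp (it))` turns monotonically and exactly once around.

Distance: at a minimum `w` of `Re Q(z) - P(-|z|)` the number `φ(ω(w))` is real, hence so is `ω(w)`,
and `ω(w) ≥ -|w|` by the Schwarz lemma. Since `φ` increases on the real axis, comparing the radial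
derivatives gives `|f'(z)| ≥ k'(-|z|)`. Integrating along the preimage of a segment, `f(𝔻)` contains
the disk of radius `-k(-1)`, which is the best possible radius for `k` and its rotations.

Majorants: for `r ≤ 1/3` Bohr's theorem applied to `ω(z)/z` bounds the majorant of `ω` at `r` by
`r`, and hence the majorant of `φ ∘ ω - 1` by that of `φ - 1`. Comparing the logarithmic derivatives
of the majorants of `f'` and `k'` through `z f'' = (φ ∘ ω - 1) f'` and `z k'' = (φ - 1) k'` yields
`M_f(r) ≤ M_k(r)`. The coefficients of `k` are nonnegative, so `M_k(r) = k(r)`, and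
`k(r) ≤ k(r_f) = -k(-1)` for `r ≤ r_f`.
-/

namespace MaMinda

/-! ### Taylor coefficients -/

theorem mem_disk {z : ℂ} : z ∈ disk ↔ ‖z‖ < 1 := mem_ball_zero_iff

theorem zero_mem_disk : (0 : ℂ) ∈ disk := Metric.mem_ball_self one_pos

theorem isOpen_disk : IsOpen disk := Metric.isOpen_ball

theorem disk_mem_nhds {z : ℂ} (hz : z ∈ disk) : disk ∈ 𝓝 z := isOpen_disk.mem_nhds hz

theorem isPreconnected_disk : IsPreconnected disk := (convex_ball (0 : ℂ) 1).isPreconnected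

theorem hasDerivAt_of_mem_disk {f : ℂ → ℂ} (hf : DifferentiableOn ℂ f disk) {z : ℂ}
    (hz : z ∈ disk) : HasDerivAt f (deriv f z) z :=
  (hf.differentiableAt (disk_mem_nhds hz)).hasDerivAt

theorem hasSum_coeff {f : ℂ → ℂ} (hf : DifferentiableOn ℂ f disk) {z : ℂ} (hz : z ∈ disk) :
    HasSum (fun n => coeff f n * z ^ n) (f z) := by
  refine (Complex.hasSum_taylorSeries_on_ball hf hz).congr_fun fun n => ?_
  simp only [coeff, sub_zero, smul_eq_mul]
  ring

theorem summable_norm_coeff {f : ℂ → ℂ} (hf : DifferentiableOn ℂ f disk) {r : ℝ} (h0 : 0 ≤ r)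
    (h1 : r < 1) : Summable fun n => ‖coeff f n‖ * r ^ n := by
  have hr : (r : ℂ) ∈ disk := by simpa [mem_disk, abs_of_nonneg h0] using h1
  simpa [abs_of_nonneg h0] using (hasSum_coeff hf hr).summable.norm

theorem coeff_eq_of_hasSum {f : ℂ → ℂ} {c : ℕ → ℂ}
    (h : ∀ᶠ z in 𝓝 0, HasSum (fun n => c n * z ^ n) (f z)) : coeff f = c := by
  have hf : HasFPowerSeriesAt f (FormalMultilinearSeries.ofScalars ℂ c) 0 := by
    simpa [hasFPowerSeriesAt_iff, FormalMultilinearSeries.coeff_ofScalars, mul_comm] using h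
  have hanalytic := hf.analyticAt.hasFPowerSeriesAt
  exact FormalMultilinearSeries.ofScalars_series_injective ℂ ℂ
    (hanalytic.eq_formalMultilinearSeries hf)

theorem coeff_eq_of_hasSum_disk {f : ℂ → ℂ} {c : ℕ → ℂ}
    (h : ∀ z ∈ disk, HasSum (fun n => c n * z ^ n) (f z)) : coeff f = c :=
  coeff_eq_of_hasSum (mem_of_superset (disk_mem_nhds zero_mem_disk) h)

theorem coeff_congr {f g : ℂ → ℂ} (h : EqOn f g disk) (n : ℕ) : coeff f n = coeff g n := by
  rw [coeff, coeff, (h.eventuallyEq_of_mem (disk_mem_nhds zero_mem_disk)).iteratedDeriv_eq]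

theorem coeff_zero (f : ℂ → ℂ) : coeff f 0 = f 0 := by simp [coeff]

theorem coeff_one (f : ℂ → ℂ) : coeff f 1 = deriv f 0 := by simp [coeff]

theorem coeff_deriv (f : ℂ → ℂ) (n : ℕ) : coeff (deriv f) n = (n + 1) * coeff f (n + 1) := by
  have hn : (n : ℂ) + 1 ≠ 0 := by exact_mod_cast n.succ_ne_zero
  simp only [coeff, iteratedDeriv_succ', Nat.factorial_succ]
  push_cast
  field_simp

theorem coeff_mul {f g : ℂ → ℂ} (hf : DifferentiableOn ℂ f disk)
    (hg : DifferentiableOn ℂ g disk) (n : ℕ) :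
    coeff (fun z => f z * g z) n
      = ∑ p ∈ Finset.HasAntidiagonal.antidiagonal n, coeff f p.1 * coeff g p.2 := by
  refine congrFun (coeff_eq_of_hasSum_disk (c := fun n =>
    ∑ p ∈ Finset.HasAntidiagonal.antidiagonal n, coeff f p.1 * coeff g p.2) fun z hz => ?_) n
  have hF := hasSum_coeff hf hz
  have hG := hasSum_coeff hg hz
  have h := (summable_norm_sum_mul_antidiagonal_of_summable_norm hF.summable.norm
    hG.summable.norm).of_norm.hasSum
  rw [← tsum_mul_tsum_eq_tsum_sum_antidiagonal_of_summable_norm hF.summable.norm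
    hG.summable.norm, hF.tsum_eq, hG.tsum_eq] at h
  refine h.congr_fun fun n => ?_
  rw [Finset.sum_mul]
  refine Finset.sum_congr rfl fun p hp => ?_
  rw [← Finset.HasAntidiagonal.mem_antidiagonal.1 hp]
  ring

theorem coeff_id_mul_succ {f : ℂ → ℂ} (hf : DifferentiableOn ℂ f disk) (n : ℕ) :
    coeff (fun z => z * f z) (n + 1) = coeff f n := by
  refine congrFun (coeff_eq_of_hasSum_disk
    (c := fun n => if n = 0 then 0 else coeff f (n - 1)) fun z hz => ?_) (n + 1)
  rw [← hasSum_nat_add_iff' 1, Finset.sum_range_one, if_pos rfl, zero_mul, sub_zero]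
  refine ((hasSum_coeff hf hz).mul_left z).congr_fun fun n => ?_
  rw [if_neg n.succ_ne_zero, Nat.add_sub_cancel]
  ring

theorem coeff_id_mul_deriv {f : ℂ → ℂ} (hf : DifferentiableOn ℂ f disk) (n : ℕ) :
    coeff (fun z => z * deriv f z) n = n * coeff f n := by
  cases n with
  | zero => simp [coeff_zero]
  | succ n => rw [coeff_id_mul_succ (hf.deriv isOpen_disk), coeff_deriv, Nat.cast_succ]

section RealCoefficients

variable {f : ℂ → ℂ} (hf : DifferentiableOn ℂ f disk) (hreal : ∀ n, (coeff f n).im = 0)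
include hf hreal

theorem apply_conj_of_real_coeff {z : ℂ} (hz : z ∈ disk) :
    f ((starRingEnd ℂ) z) = (starRingEnd ℂ) (f z) := by
  refine (hasSum_coeff hf (by simpa [mem_disk] using hz)).unique ?_
  convert Complex.hasSum_conj'.2 (hasSum_coeff hf hz) using 2 with n
  simp [Complex.conj_eq_iff_im.2 (hreal n)]

theorem im_apply_ofReal_of_real_coeff {t : ℝ} (ht : |t| < 1) : (f t).im = 0 := by
  have h := apply_conj_of_real_coeff hf hreal (z := t) (by simpa [mem_disk] using ht)
  rw [Complex.conj_ofReal] at h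
  exact Complex.conj_eq_iff_im.1 h.symm

theorem im_eq_zero_of_im_apply_eq_zero (hinj : InjOn f disk) {z : ℂ} (hz : z ∈ disk)
    (h : (f z).im = 0) : z.im = 0 := by
  refine Complex.conj_eq_iff_im.1 (hinj (by simpa [mem_disk] using hz) hz ?_)
  rw [apply_conj_of_real_coeff hf hreal hz, Complex.conj_eq_iff_im.2 h]

end RealCoefficients

/-! ### Logarithms of derivatives -/

theorem exists_euler_primitive {ψ : ℂ → ℂ} (hψ : DifferentiableOn ℂ ψ disk) (h0 : ψ 0 = 0) :
    ∃ Q : ℂ → ℂ, DifferentiableOn ℂ Q disk ∧ Q 0 = 0 ∧ ∀ z ∈ disk, z * deriv Q z = ψ z := by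
  have hd : DifferentiableOn ℂ (dslope ψ 0) disk :=
    (Complex.differentiableOn_dslope (disk_mem_nhds zero_mem_disk)).2 hψ
  obtain ⟨Q, hQ0, hQ⟩ := (DifferentiableOn.isExactOn_ball hd).with_val_at 0 0
  refine ⟨Q, fun z hz => (hQ z hz).differentiableAt.differentiableWithinAt, hQ0, fun z hz => ?_⟩
  rw [(hQ z hz).deriv]
  simpa [h0] using sub_smul_dslope ψ 0 z

theorem eq_apply_zero_of_id_mul_deriv_eq_zero {h : ℂ → ℂ} (hh : DifferentiableOn ℂ h disk)
    (h' : ∀ z ∈ disk, z * deriv h z = 0) {z : ℂ} (hz : z ∈ disk) : h z = h 0 := by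
  have hcoeff (n : ℕ) (hn : n ≠ 0) : coeff h n = 0 := by
    have hn' : (n : ℂ) * coeff h n = coeff 0 n :=
      (coeff_id_mul_deriv hh n).symm.trans (coeff_congr h' n)
    simpa [hn, coeff] using hn'
  refine (hasSum_coeff hh hz).unique ?_
  simpa [coeff_zero] using hasSum_single (f := fun n => coeff h n * z ^ n) 0
    fun n hn => by simp [hcoeff n hn]

theorem eq_mul_exp_of_id_mul_deriv_eq {g Q : ℂ → ℂ} (hg : DifferentiableOn ℂ g disk)
    (hQ : DifferentiableOn ℂ Q disk)
    (h : ∀ z ∈ disk, z * deriv g z = z * deriv Q z * g z) {z : ℂ} (hz : z ∈ disk) :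
    g z = g 0 * Complex.exp (Q z - Q 0) := by
  have hconst : g z * Complex.exp (-Q z) = g 0 * Complex.exp (-Q 0) := by
    refine eq_apply_zero_of_id_mul_deriv_eq_zero (h := fun z => g z * Complex.exp (-Q z))
      (hg.fun_mul hQ.fun_neg.cexp) (fun w hw => ?_) hz
    have hd := (hasDerivAt_of_mem_disk hg hw).fun_mul (hasDerivAt_of_mem_disk hQ hw).fun_neg.cexp
    rw [hd.deriv]
    linear_combination Complex.exp (-Q w) * h w hw
  rw [Complex.exp_sub, mul_div_assoc', div_eq_mul_inv, mul_right_comm, ← Complex.exp_neg, ← hconst,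
    mul_assoc, ← Complex.exp_add, neg_add_cancel, Complex.exp_zero, mul_one]

/-- The quotient `z f'' / f'` is only meaningful where `f' ≠ 0`; that this is everywhere is not
known beforehand, so the identity is first obtained near `0` and then propagated. -/
theorem IsUnivalentNormalized.id_mul_deriv_deriv_eq {f χ : ℂ → ℂ} (hf : IsUnivalentNormalized f)
    (hχ : DifferentiableOn ℂ χ disk) (hq : ∀ z ∈ disk, convexityQuotient f z = χ z) {z : ℂ}
    (hz : z ∈ disk) : z * deriv (deriv f) z = (χ z - 1) * deriv f z := by
  have hf' := hf.analytic.deriv isOpen_disk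
  have hne : ∀ᶠ w in 𝓝 (0 : ℂ), deriv f w ≠ 0 :=
    (hf'.continuousOn.continuousAt (disk_mem_nhds zero_mem_disk)).eventually_ne
      (by simp [hf.deriv_zero])
  have hnear : (fun w => w * deriv (deriv f) w) =ᶠ[𝓝 0] fun w => (χ w - 1) * deriv f w := by
    filter_upwards [hne, disk_mem_nhds zero_mem_disk] with w hw hwd
    rw [← hq w hwd, convexityQuotient, add_sub_cancel_left, div_mul_cancel₀ _ hw]
  exact ((differentiableOn_id (𝕜 := ℂ)).fun_mul (hf'.deriv isOpen_disk)).analyticOnNhd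
    isOpen_disk |>.eqOn_of_preconnected_of_eventuallyEq
    (((hχ.sub_const 1).fun_mul hf').analyticOnNhd isOpen_disk) isPreconnected_disk zero_mem_disk
    hnear hz

theorem IsUnivalentNormalized.exists_log_deriv {f χ : ℂ → ℂ} (hf : IsUnivalentNormalized f)
    (hχ : DifferentiableOn ℂ χ disk) (h0 : χ 0 = 1)
    (hq : ∀ z ∈ disk, convexityQuotient f z = χ z) :
    ∃ Q : ℂ → ℂ, DifferentiableOn ℂ Q disk ∧ Q 0 = 0 ∧ (∀ z ∈ disk, z * deriv Q z = χ z - 1) ∧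
      ∀ z ∈ disk, deriv f z = Complex.exp (Q z) := by
  obtain ⟨Q, hQ, hQ0, hQχ⟩ := exists_euler_primitive (hχ.sub_const 1) (by simp [h0])
  refine ⟨Q, hQ, hQ0, hQχ, fun z hz => ?_⟩
  rw [eq_mul_exp_of_id_mul_deriv_eq (hf.analytic.deriv isOpen_disk) hQ (fun w hw => by
    rw [hQχ w hw, hf.id_mul_deriv_deriv_eq hχ hq hw]) hz, hf.deriv_zero, hQ0, one_mul, sub_zero]

/-! ### Univalence of convex functions -/

section TangentAngle

variable {γ G : ℝ → ℂ} (hγ : ∀ t, HasDerivAt γ (Complex.exp (G t)) t)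
  (hG : StrictMono fun t => (G t).im)
include hγ hG

theorem ne_of_tangent_turns_le_pi {a b : ℝ} (hab : a < b)
    (hturn : (G b).im - (G a).im ≤ Real.pi) : γ a ≠ γ b := by
  -- The curve advances strictly in the direction of the bisector of the two end tangents.
  set μ : ℝ := ((G a).im + (G b).im) / 2 with hμ
  have hd (t : ℝ) : HasDerivAt (fun t => (γ t * Complex.exp (-(μ * Complex.I))).re)
      (Real.exp (G t).re * Real.cos ((G t).im - μ)) t := by
    refine (Complex.reCLM.hasFDerivAt.comp_hasDerivAt t ((hγ t).mul_const _)).congr_deriv ?_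
    rw [Complex.reCLM_apply, ← Complex.exp_add, Complex.exp_re]
    simp [sub_eq_add_neg]
  have hmono : StrictMonoOn (fun t => (γ t * Complex.exp (-(μ * Complex.I))).re) (Icc a b) := by
    refine strictMonoOn_of_deriv_pos (convex_Icc a b)
      (fun t _ => (hd t).continuousAt.continuousWithinAt) fun t ht => ?_
    rw [interior_Icc] at ht
    have ha := hG ht.1
    have hb := hG ht.2
    rw [(hd t).deriv]
    exact mul_pos (Real.exp_pos _) (Real.cos_pos_of_mem_Ioo ⟨by linarith, by linarith⟩)
  intro h
  have hlt := hmono (left_mem_Icc.2 hab.le) (right_mem_Icc.2 hab.le) hab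
  simp only [h, lt_irrefl] at hlt

theorem injOn_of_tangent_winds_once {T : ℝ} (hper : Function.Periodic γ T)
    (hwind : ∀ t, (G (t + T)).im = (G t).im + 2 * Real.pi) (a : ℝ) :
    InjOn γ (Ioc a (a + T)) := by
  have hne {s t : ℝ} (hst : s < t) (hts : t < s + T) : γ s ≠ γ t := by
    by_cases h : (G t).im - (G s).im ≤ Real.pi
    · exact ne_of_tangent_turns_le_pi hγ hG hst h
    · have := ne_of_tangent_turns_le_pi hγ hG hts (by rw [hwind]; linarith)
      rw [hper] at this
      exact this.symm
  intro s hs t ht hst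
  by_contra h
  rcases lt_or_gt_of_ne h with h | h
  · exact hne h (by linarith [hs.1, ht.2]) hst
  · exact hne h (by linarith [ht.1, hs.2]) hst.symm

end TangentAngle

theorem circleMap_mem_disk {R : ℝ} (h0 : 0 ≤ R) (h1 : R < 1) (t : ℝ) :
    circleMap 0 R t ∈ disk := by
  rwa [mem_disk, norm_circleMap_zero, abs_of_nonneg h0]

theorem injOn_sphere_of_re_pos {k P : ℂ → ℂ} (hk : DifferentiableOn ℂ k disk)
    (hP : DifferentiableOn ℂ P disk) (hkP : ∀ z ∈ disk, deriv k z = Complex.exp (P z))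
    (hre : ∀ z ∈ disk, 0 < (1 + z * deriv P z).re) {R : ℝ} (h0 : 0 < R) (h1 : R < 1) :
    InjOn k (Metric.sphere 0 R) := by
  have hmem := circleMap_mem_disk h0.le h1
  -- The logarithm of the derivative of `t ↦ k (R e ^ (i t))`.
  let G (t : ℝ) : ℂ := P (circleMap 0 R t) + (Real.log R + (t + Real.pi / 2) * Complex.I)
  have hGim (t : ℝ) : (G t).im = (P (circleMap 0 R t)).im + (t + Real.pi / 2) := by simp [G]
  have hγ (t : ℝ) : HasDerivAt (k ∘ circleMap 0 R) (Complex.exp (G t)) t := by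
    refine ((hasDerivAt_of_mem_disk hk (hmem t)).comp t (hasDerivAt_circleMap 0 R t)).congr_deriv ?_
    rw [hkP _ (hmem t), Complex.exp_add, Complex.exp_add, add_mul, Complex.exp_add,
      Complex.exp_pi_div_two_mul_I, ← Complex.ofReal_exp, Real.exp_log h0, circleMap_zero]
    ring
  have hGmono : StrictMono fun t => (G t).im := by
    have hd (t : ℝ) : HasDerivAt (fun t => (G t).im)
        (1 + circleMap 0 R t * deriv P (circleMap 0 R t)).re t := by
      have hP' := (hasDerivAt_of_mem_disk hP (hmem t)).comp t (hasDerivAt_circleMap 0 R t)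
      simp only [hGim]
      refine ((Complex.imCLM.hasFDerivAt.comp_hasDerivAt t hP').add
        ((hasDerivAt_id t).add_const (Real.pi / 2))).congr_deriv ?_
      simp
      ring
    exact strictMono_of_deriv_pos fun t => by rw [(hd t).deriv]; exact hre _ (hmem t)
  have hinj := injOn_of_tangent_winds_once hγ hGmono ((periodic_circleMap 0 R).comp k)
    (fun t => by rw [hGim, hGim, periodic_circleMap]; ring) 0
  rw [← abs_of_pos h0, ← image_circleMap_Ioc, ← zero_add (2 * Real.pi)]
  exact hinj.image_of_comp

theorem le_norm_of_forall_frontier_le_norm {U : Set ℂ} (hU : Bornology.IsBounded U) {g : ℂ → ℂ}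
    (hg : DiffContOnCl ℂ g U) (hne : ∀ z ∈ closure U, g z ≠ 0) {c : ℝ} (hc : 0 < c)
    (hfr : ∀ z ∈ frontier U, c ≤ ‖g z‖) {z : ℂ} (hz : z ∈ closure U) : c ≤ ‖g z‖ := by
  have h := Complex.norm_le_of_forall_mem_frontier_norm_le hU (hg.inv hne) (C := c⁻¹)
    (fun w hw => by simpa using inv_anti₀ hc (hfr w hw)) hz
  rw [Pi.inv_apply, norm_inv] at h
  exact (inv_le_inv₀ (norm_pos_iff.2 (hne z hz)) hc).1 h

/-- A form of Hurwitz's theorem. -/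
theorem forall_ne_zero_of_forall_frontier_ne_zero {X : Type*} [TopologicalSpace X] [CompactSpace X]
    [PreconnectedSpace X] {U : Set ℂ} (hU : Bornology.IsBounded U) {F : X → ℂ → ℂ}
    (hF : Continuous fun p : X × closure U => F p.1 p.2) (hd : ∀ x, DifferentiableOn ℂ (F x) U)
    (hfr : ∀ x, ∀ z ∈ frontier U, F x z ≠ 0) {x₀ : X} (h₀ : ∀ z ∈ closure U, F x₀ z ≠ 0) (x : X)
    {z : ℂ} (hz : z ∈ closure U) : F x z ≠ 0 := by
  have : CompactSpace (closure U) := isCompact_iff_compactSpace.1 hU.isCompact_closure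
  obtain ⟨c, hc, hcF⟩ : ∃ c, 0 < c ∧
      ∀ p ∈ {p : X × closure U | (p.2 : ℂ) ∈ frontier U}, c ≤ ‖F p.1 p.2‖ :=
    (isClosed_frontier.preimage (by fun_prop)).isCompact.exists_forall_le' hF.norm.continuousOn
      fun p hp => norm_pos_iff.2 (hfr p.1 p.2 hp)
  have hFx (x : X) : DiffContOnCl ℂ (F x) U :=
    ⟨hd x, continuousOn_iff_continuous_domRestrict.2 (hF.comp (Continuous.prodMk_right x))⟩
  have hclosed : IsClosed {x | ∀ z ∈ closure U, F x z ≠ 0} := by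
    have : {x | ∀ z ∈ closure U, F x z ≠ 0} = ⋂ z : closure U, {x | c ≤ ‖F x z‖} := by
      ext x
      simp only [mem_ofPred_eq, mem_iInter]
      exact ⟨fun h z => le_norm_of_forall_frontier_le_norm hU (hFx x) h hc
          (fun w hw => hcF (x, ⟨w, frontier_subset_closure hw⟩) hw) z.2,
        fun h z hz => norm_pos_iff.1 (hc.trans_le (h ⟨z, hz⟩))⟩
    rw [this]
    exact isClosed_iInter fun z => isClosed_le continuous_const
      (hF.comp (Continuous.prodMk_left z)).norm
  have hopen : IsOpen {x | ∀ z ∈ closure U, F x z ≠ 0} := by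
    have : {x | ∀ z ∈ closure U, F x z ≠ 0}ᶜ =
        Prod.fst '' {p : X × closure U | F p.1 p.2 = 0} := by
      ext x
      simp
    rw [← isClosed_compl_iff, this]
    exact isClosedMap_fst_of_compactSpace _ (isClosed_eq hF continuous_const)
  exact eq_univ_iff_forall.1 (IsClopen.eq_univ ⟨hclosed, hopen⟩ ⟨x₀, h₀⟩) x z hz

/-- The divided difference `(k z - k (l z)) / (z - l z)` of `k` along the chord from `l z` to `z`,
as a power series, so that it is also defined for `z = 0` and for `l = 1`. -/
noncomputable def chordQuotient (k : ℂ → ℂ) (z l : ℂ) : ℂ :=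
  ∑' n : ℕ, coeff k (n + 1) * z ^ n * ∑ j ∈ Finset.range (n + 1), l ^ j

theorem chordQuotient_zero_left (k : ℂ → ℂ) (l : ℂ) : chordQuotient k 0 l = deriv k 0 := by
  rw [chordQuotient, tsum_eq_single 0 fun n hn => by simp [hn]]
  simp [coeff_one]

theorem norm_chordQuotient_term_le (k : ℂ → ℂ) {z l : ℂ} {R : ℝ} (hz : ‖z‖ ≤ R) (hl : ‖l‖ ≤ 1)
    (n : ℕ) : ‖coeff k (n + 1) * z ^ n * ∑ j ∈ Finset.range (n + 1), l ^ j‖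
      ≤ ‖coeff (deriv k) n‖ * R ^ n := by
  have hsum : ‖∑ j ∈ Finset.range (n + 1), l ^ j‖ ≤ n + 1 :=
    (norm_sum_le_of_le (n := fun _ => (1 : ℝ)) _ fun j _ => by
      rw [norm_pow]; exact pow_le_one₀ (norm_nonneg _) hl).trans (by simp)
  have hcoeff : ‖coeff (deriv k) n‖ = (n + 1) * ‖coeff k (n + 1)‖ := by
    rw [coeff_deriv, norm_mul, ← Nat.cast_succ, Complex.norm_natCast, Nat.cast_succ]
  have hR : 0 ≤ R := (norm_nonneg z).trans hz
  calc ‖coeff k (n + 1) * z ^ n * ∑ j ∈ Finset.range (n + 1), l ^ j‖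
      = ‖coeff k (n + 1)‖ * ‖z‖ ^ n * ‖∑ j ∈ Finset.range (n + 1), l ^ j‖ := by
        rw [norm_mul, norm_mul, norm_pow]
    _ ≤ ‖coeff k (n + 1)‖ * R ^ n * (n + 1) := by gcongr
    _ = ‖coeff (deriv k) n‖ * R ^ n := by rw [hcoeff]; ring

section ChordQuotient

variable {k : ℂ → ℂ} (hk : DifferentiableOn ℂ k disk)

include hk

theorem continuousOn_chordQuotient {R : ℝ} (h0 : 0 ≤ R) (h1 : R < 1) :
    ContinuousOn (fun p : ℂ × ℂ => chordQuotient k p.1 p.2)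
      (Metric.closedBall 0 R ×ˢ Metric.closedBall 0 1) := by
  refine continuousOn_tsum (fun n => by fun_prop)
    (summable_norm_coeff (hk.deriv isOpen_disk) h0 h1) fun n p hp => ?_
  exact norm_chordQuotient_term_le k (by simpa using hp.1) (by simpa using hp.2) n

theorem differentiableOn_chordQuotient {z : ℂ} (hz : z ∈ disk) :
    DifferentiableOn ℂ (chordQuotient k z) disk :=
  Complex.differentiableOn_tsum_of_summable_norm
    (summable_norm_coeff (hk.deriv isOpen_disk) (norm_nonneg z) (mem_disk.1 hz))
    (fun n => by fun_prop) isOpen_disk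
    fun n _ hl => norm_chordQuotient_term_le k le_rfl (mem_disk.1 hl).le n

theorem mul_chordQuotient {z l : ℂ} (hz : z ∈ disk) (hl : ‖l‖ ≤ 1) :
    z * (1 - l) * chordQuotient k z l = k z - k (l * z) := by
  have hlz : l * z ∈ disk := by
    rw [mem_disk, norm_mul]
    exact (mul_le_of_le_one_left (norm_nonneg z) hl).trans_lt (mem_disk.1 hz)
  have h := (hasSum_coeff hk hz).sub (hasSum_coeff hk hlz)
  rw [← hasSum_nat_add_iff' 1] at h
  simp only [Finset.range_one, Finset.sum_singleton, pow_zero, mul_one, sub_self, sub_zero] at h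
  rw [chordQuotient, ← tsum_mul_left, ← h.tsum_eq]
  refine tsum_congr fun n => ?_
  rw [mul_pow]
  linear_combination coeff k (n + 1) * z ^ (n + 1) * mul_neg_geom_sum l (n + 1)

theorem chordQuotient_one_right {z : ℂ} (hz : z ∈ disk) : chordQuotient k z 1 = deriv k z := by
  rw [← (hasSum_coeff (hk.deriv isOpen_disk) hz).tsum_eq]
  refine tsum_congr fun n => ?_
  simp only [coeff_deriv, one_pow, Finset.sum_const, Finset.card_range, nsmul_eq_mul, mul_one]
  push_cast
  ring

variable (hd : ∀ z ∈ disk, deriv k z ≠ 0)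
  (hinj : ∀ R : ℝ, 0 < R → R < 1 → InjOn k (Metric.sphere 0 R))
include hd hinj

theorem chordQuotient_ne_zero_of_norm_eq_one {z l : ℂ} (hz : z ∈ disk) (hl : ‖l‖ = 1) :
    chordQuotient k z l ≠ 0 := by
  rcases eq_or_ne l 1 with rfl | hl1
  · rw [chordQuotient_one_right hk hz]
    exact hd z hz
  rcases eq_or_ne z 0 with rfl | hz0
  · rw [chordQuotient_zero_left]
    exact hd 0 zero_mem_disk
  have hne : l * z ≠ z := fun h => hl1 (mul_right_cancel₀ hz0 (by rw [h, one_mul]))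
  have hk_ne := (hinj ‖z‖ (norm_pos_iff.2 hz0) (mem_disk.1 hz)).ne (by simp [hl])
    (by simp) hne
  exact right_ne_zero_of_mul (a := z * (1 - l)) <| by
    rw [mul_chordQuotient hk hz hl.le]
    exact sub_ne_zero.2 hk_ne.symm

theorem chordQuotient_ne_zero {z l : ℂ} (hz : z ∈ disk) (hl : ‖l‖ ≤ 1) :
    chordQuotient k z l ≠ 0 := by
  have hnorm (t : unitInterval) : ‖((t : ℝ) : ℂ) * z‖ ≤ ‖z‖ := by
    rw [norm_mul, Complex.norm_real, Real.norm_of_nonneg t.2.1]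
    exact mul_le_of_le_one_left (norm_nonneg z) t.2.2
  have hmem (t : unitInterval) : ((t : ℝ) : ℂ) * z ∈ disk :=
    mem_disk.2 ((hnorm t).trans_lt (mem_disk.1 hz))
  have hcont : Continuous fun p : unitInterval × closure disk =>
      chordQuotient k ((p.1 : ℝ) * z) p.2 := by
    refine (continuousOn_chordQuotient hk (norm_nonneg z) (mem_disk.1 hz)).comp_continuous
      (f := fun p : unitInterval × closure disk => (((p.1 : ℝ) : ℂ) * z, (p.2 : ℂ)))
      (by fun_prop) fun p => ⟨by simpa using hnorm p.1, Metric.closure_ball_subset_closedBall p.2.2⟩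
  -- Shrink `z` to `0`, where the divided difference is the constant `k' 0`.
  have h := forall_ne_zero_of_forall_frontier_ne_zero Metric.isBounded_ball hcont
    (fun t => differentiableOn_chordQuotient hk (hmem t))
    (fun t l hl => chordQuotient_ne_zero_of_norm_eq_one hk hd hinj (hmem t)
      (by simpa [disk, frontier_ball] using hl))
    (x₀ := 0) (fun l _ => by simpa [chordQuotient_zero_left] using hd 0 zero_mem_disk) 1
    (z := l) (by simpa [disk, closure_ball] using hl)
  simpa using h

theorem injOn_of_injOn_spheres : InjOn k disk := by
  have hle {z w : ℂ} (hz : z ∈ disk) (hwz : ‖w‖ ≤ ‖z‖) (h : k z = k w) : z = w := by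
    rcases eq_or_ne z 0 with rfl | hz0
    · exact (norm_le_zero_iff.1 (by simpa using hwz)).symm
    have hl : ‖w / z‖ ≤ 1 := by
      rw [norm_div]
      exact div_le_one_of_le₀ hwz (norm_nonneg z)
    have hmul := mul_chordQuotient hk hz hl
    rw [div_mul_cancel₀ w hz0, h, sub_self, mul_eq_zero,
      or_iff_left (chordQuotient_ne_zero hk hd hinj hz hl), mul_eq_zero, or_iff_right hz0,
      sub_eq_zero, eq_div_iff hz0, one_mul] at hmul
    exact hmul
  intro z hz w hw h
  rcases le_total ‖w‖ ‖z‖ with hwz | hzw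
  · exact hle hz hwz h
  · exact (hle hw hzw h.symm).symm

end ChordQuotient

theorem exists_isConvexExtremal {φ : ℂ → ℂ} (hφ : DifferentiableOn ℂ φ disk)
    (hre : ∀ z ∈ disk, 0 < (φ z).re) (h0 : φ 0 = 1) : ∃ k, IsConvexExtremal φ k := by
  obtain ⟨P, hP, hP0, hPφ⟩ := exists_euler_primitive (hφ.sub_const 1) (by simp [h0])
  obtain ⟨k, hk0, hk⟩ := (DifferentiableOn.isExactOn_ball hP.cexp).with_val_at 0 0
  have hkd : DifferentiableOn ℂ k disk :=
    fun z hz => (hk z hz).differentiableAt.differentiableWithinAt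
  have hk' (z : ℂ) (hz : z ∈ disk) : deriv k z = Complex.exp (P z) := (hk z hz).deriv
  have hPφ' (z : ℂ) (hz : z ∈ disk) : 1 + z * deriv P z = φ z := by rw [hPφ z hz]; ring
  refine ⟨k, ⟨hkd, hk0, by rw [hk' 0 zero_mem_disk, hP0, Complex.exp_zero], ?_⟩, fun z hz => ?_⟩
  · exact injOn_of_injOn_spheres hkd (fun z hz => by rw [hk' z hz]; exact Complex.exp_ne_zero _)
      fun R h0 h1 => injOn_sphere_of_re_pos hkd hP hk'
        (fun z hz => by rw [hPφ' z hz]; exact hre z hz) h0 h1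
  · have hk'' : deriv (deriv k) z = Complex.exp (P z) * deriv P z := by
      rw [(EqOn.eventuallyEq_of_mem hk' (disk_mem_nhds hz)).deriv_eq,
        (hasDerivAt_of_mem_disk hP hz).cexp.deriv]
    rw [convexityQuotient, hk'', hk' z hz, ← hPφ' z hz, mul_left_comm,
      mul_div_cancel_left₀ _ (Complex.exp_ne_zero _)]

/-! ### Distortion -/

open scoped ComplexOrder

/-- Univalent functions on the disk with nonnegative Taylor coefficients, normalized by `φ 0 = 1`.
In the order of `ℂ`, `0 ≤ coeff φ n` says that the coefficient is real and nonnegative. -/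
structure IsPositiveUnivalent (φ : ℂ → ℂ) : Prop where
  analytic : DifferentiableOn ℂ φ disk
  univalent : InjOn φ disk
  map_zero : φ 0 = 1
  coeff_nonneg : ∀ n, 0 ≤ coeff φ n

theorem ofReal_mem_disk {t : ℝ} (ht : t ∈ Ioo (-1) 1) : (t : ℂ) ∈ disk := by
  simpa [mem_disk, abs_lt] using ht

namespace IsPositiveUnivalent

variable {φ : ℂ → ℂ} (hφ : IsPositiveUnivalent φ)
include hφ

theorem im_coeff (n : ℕ) : (coeff φ n).im = 0 := (Complex.nonneg_iff.1 (hφ.coeff_nonneg n)).2.symm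

theorem apply_zero_le_apply_ofReal {t : ℝ} (h0 : 0 ≤ t) (h1 : t < 1) : φ 0 ≤ φ t := by
  have h := (hasSum_coeff hφ.analytic (ofReal_mem_disk ⟨by linarith, h1⟩))
  have ht : (0 : ℂ) ≤ t := Complex.zero_le_real.2 h0
  simpa [coeff_zero] using
    le_hasSum h 0 fun n _ => mul_nonneg (hφ.coeff_nonneg n) (pow_nonneg ht n)

theorem strictMonoOn_re : StrictMonoOn (fun t : ℝ => (φ t).re) (Ioo (-1) 1) := by
  have hcont : ContinuousOn (fun t : ℝ => (φ t).re) (Ioo (-1) 1) :=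
    Complex.continuous_re.comp_continuousOn <| hφ.analytic.continuousOn.comp
      Complex.continuous_ofReal.continuousOn fun _ ht => ofReal_mem_disk ht
  have hinj : InjOn (fun t : ℝ => (φ t).re) (Ioo (-1) 1) := fun s hs t ht hst =>
    Complex.ofReal_injective <| hφ.univalent (ofReal_mem_disk hs) (ofReal_mem_disk ht) <|
      Complex.ext hst <| by
        rw [im_apply_ofReal_of_real_coeff hφ.analytic hφ.im_coeff (abs_lt.2 hs),
          im_apply_ofReal_of_real_coeff hφ.analytic hφ.im_coeff (abs_lt.2 ht)]
  refine (hcont.strictMonoOn_of_injOn_Ioo (by norm_num) hinj).resolve_right fun hanti => ?_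
  have h := hanti (show (0 : ℝ) ∈ Ioo (-1) 1 by norm_num)
    (show (1 / 2 : ℝ) ∈ Ioo (-1) 1 by norm_num) (by norm_num)
  have hle := (Complex.le_def.1
    (hφ.apply_zero_le_apply_ofReal (t := 1 / 2) (by norm_num) (by norm_num))).1
  exact h.not_ge (by simpa using hle)

end IsPositiveUnivalent

theorem IsConvexClass.exists_log_deriv {φ f : ℂ → ℂ} (hf : IsConvexClass φ f)
    (hφ : DifferentiableOn ℂ φ disk) (h0 : φ 0 = 1) :
    ∃ ω Q : ℂ → ℂ, (DifferentiableOn ℂ ω disk ∧ MapsTo ω disk disk ∧ ω 0 = 0) ∧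
      DifferentiableOn ℂ Q disk ∧ Q 0 = 0 ∧ (∀ z ∈ disk, z * deriv Q z = φ (ω z) - 1) ∧
      ∀ z ∈ disk, deriv f z = Complex.exp (Q z) := by
  obtain ⟨hfS, ω, hω, hωd, hω0, hfω⟩ := hf
  obtain ⟨Q, hQ⟩ := hfS.exists_log_deriv (χ := fun z => φ (ω z)) (hφ.comp hω hωd)
    (by simp only [hω0, h0]) hfω
  exact ⟨ω, Q, ⟨hω, hωd, hω0⟩, hQ⟩

namespace IsConvexExtremal

variable {φ k : ℂ → ℂ} (hφ : IsPositiveUnivalent φ) (hk : IsConvexExtremal φ k)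
include hφ hk

theorem exists_real_log_deriv : ∃ p p' : ℝ → ℝ, p 0 = 0 ∧ ∀ t ∈ Ioo (-1 : ℝ) 1,
    HasDerivAt p (p' t) t ∧ t * p' t = (φ t).re - 1 ∧ deriv k t = Real.exp (p t) := by
  obtain ⟨P, hP, hP0, hPφ, hkP⟩ := hk.1.exists_log_deriv hφ.analytic hφ.map_zero hk.2
  have him (n : ℕ) : (coeff P n).im = 0 := by
    cases n with
    | zero => rw [coeff_zero, hP0, Complex.zero_im]
    | succ n =>
      have h : coeff φ (n + 1) = ((n + 1 : ℕ) : ℂ) * coeff P (n + 1) := by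
        rw [← coeff_id_mul_deriv hP, coeff_congr hPφ]
        simp only [coeff, iteratedDeriv_succ', deriv_sub_const_fun]
      have him := hφ.im_coeff (n + 1)
      rw [h, ← Complex.ofReal_natCast, Complex.im_ofReal_mul, mul_eq_zero] at him
      exact him.resolve_left (by exact_mod_cast n.succ_ne_zero)
  refine ⟨fun t => (P t).re, fun t => (deriv P t).re, by simp [hP0], fun t ht => ?_⟩
  have htd := ofReal_mem_disk ht
  refine ⟨(hasDerivAt_of_mem_disk hP htd).real_of_complex, ?_, ?_⟩
  · simpa using congrArg Complex.re (hPφ t htd)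
  · rw [hkP t htd, Complex.ofReal_exp]
    congr 1
    exact Complex.ext rfl (im_apply_ofReal_of_real_coeff hP him (abs_lt.2 ht))

theorem re_deriv_ofReal_pos {t : ℝ} (ht : t ∈ Ioo (-1 : ℝ) 1) : 0 < (deriv k t).re := by
  obtain ⟨p, p', -, hp⟩ := hk.exists_real_log_deriv hφ
  rw [(hp t ht).2.2, Complex.ofReal_re]
  exact Real.exp_pos _

theorem re_deriv_ofReal_lt_one {t : ℝ} (ht : t ∈ Ioo (-1 : ℝ) 0) : (deriv k t).re < 1 := by
  obtain ⟨p, p', hp0, hp⟩ := hk.exists_real_log_deriv hφ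
  have hsub : Ioc (-1 : ℝ) 0 ⊆ Ioo (-1) 1 := fun x hx => ⟨hx.1, hx.2.trans_lt one_pos⟩
  have hmono : StrictMonoOn p (Ioc (-1) 0) := by
    refine strictMonoOn_of_deriv_pos (convex_Ioc _ _)
      (fun x hx => (hp x (hsub hx)).1.continuousAt.continuousWithinAt) fun x hx => ?_
    have hx' := hsub (interior_subset hx)
    rw [interior_Ioc] at hx
    have hφx : (φ x).re < 1 := by
      simpa [hφ.map_zero] using hφ.strictMonoOn_re hx' (by norm_num : (0 : ℝ) ∈ Ioo (-1) 1) hx.2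
    rw [(hp x hx').1.deriv]
    have := (hp x hx').2.1
    exact pos_of_mul_neg_right (by linarith) hx.2.le
  have hlt := hmono (Ioo_subset_Ioc_self ht) (by norm_num) ht.2
  rw [(hp t (hsub (Ioo_subset_Ioc_self ht))).2.2, Complex.ofReal_re, Real.exp_lt_one_iff]
  rwa [hp0] at hlt

end IsConvexExtremal

theorem not_forall_le_of_hasDerivAt_pos {h : ℝ → ℝ} {D a b : ℝ} (hab : a < b)
    (hD : HasDerivAt h D b) (hpos : 0 < D) : ¬ ∀ t ∈ Ioo a b, h b ≤ h t := by
  intro hmin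
  have hslope : ∀ᶠ t in 𝓝[<] b, 0 < slope h b t :=
    ((hasDerivAt_iff_tendsto_slope.1 hD).eventually_const_lt hpos).filter_mono
      (nhdsWithin_mono _ fun t (ht : t < b) => ht.ne)
  obtain ⟨t, htpos, ht⟩ := (hslope.and (Ioo_mem_nhdsLT hab)).exists
  rw [slope_def_field] at htpos
  exact htpos.not_ge
    (div_nonpos_of_nonneg_of_nonpos (sub_nonneg.2 (hmin t ht)) (sub_nonpos.2 ht.2.le))

section RadialComparison

variable {Q : ℂ → ℂ} {w : ℂ}

theorem hasDerivAt_re_radial (hQ : DifferentiableAt ℂ Q w) :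
    HasDerivAt (fun t : ℝ => (Q (t * w)).re) (w * deriv Q w).re 1 := by
  have hc : HasDerivAt (fun t : ℂ => t * w) w ((1 : ℝ) : ℂ) := by
    simpa using (hasDerivAt_id ((1 : ℝ) : ℂ)).mul_const w
  have hQd : HasDerivAt Q (deriv Q w) (((1 : ℝ) : ℂ) * w) := by simpa using hQ.hasDerivAt
  exact (hQd.comp ((1 : ℝ) : ℂ) hc).real_of_complex.congr_deriv (by rw [mul_comm])

theorem im_id_mul_deriv_eq_zero_of_isMinOn_sphere (hQ : DifferentiableAt ℂ Q w)
    (hmin : IsMinOn (fun z => (Q z).re) (Metric.sphere 0 ‖w‖) w) : (w * deriv Q w).im = 0 := by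
  have hc : HasDerivAt (fun t : ℂ => w * Complex.exp (t * Complex.I)) (w * Complex.I)
      ((0 : ℝ) : ℂ) :=
    (((hasDerivAt_id ((0 : ℝ) : ℂ)).mul_const Complex.I).cexp.const_mul w).congr_deriv (by simp)
  have hQd : HasDerivAt Q (deriv Q w) (w * Complex.exp ((0 : ℝ) * Complex.I)) := by
    simpa using hQ.hasDerivAt
  have hloc : IsLocalMin (fun t : ℝ => (Q (w * Complex.exp (t * Complex.I))).re) 0 :=
    Eventually.of_forall fun t => by
      simpa using hmin (show w * Complex.exp (t * Complex.I) ∈ Metric.sphere 0 ‖w‖ by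
        rw [mem_sphere_zero_iff_norm, norm_mul, Complex.norm_exp_ofReal_mul_I, mul_one])
  have h0 := hloc.hasDerivAt_eq_zero (hQd.comp ((0 : ℝ) : ℂ) hc).real_of_complex
  rwa [← mul_assoc, mul_comm (deriv Q w), Complex.mul_I_re, neg_eq_zero] at h0

theorem le_re_of_radial_deriv_lt (hQ : DifferentiableOn ℂ Q disk) {p p' : ℝ → ℝ}
    (hp : ∀ t ∈ Ico (0 : ℝ) 1, HasDerivAt p (p' t) t) (h0 : p 0 ≤ (Q 0).re)
    (h : ∀ w ∈ disk, w ≠ 0 → (w * deriv Q w).im = 0 → ‖w‖ * p' ‖w‖ < (w * deriv Q w).re) {z : ℂ}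
    (hz : z ∈ disk) : p ‖z‖ ≤ (Q z).re := by
  set u : ℂ → ℝ := fun w => (Q w).re - p ‖w‖ with hu
  have hsub : Metric.closedBall (0 : ℂ) ‖z‖ ⊆ disk :=
    Metric.closedBall_subset_ball (mem_disk.1 hz)
  have hucont : ContinuousOn u (Metric.closedBall 0 ‖z‖) :=
    (Complex.continuous_re.comp_continuousOn (hQ.continuousOn.mono hsub)).sub fun w hw =>
      (ContinuousAt.comp (hp ‖w‖ ⟨norm_nonneg w, mem_disk.1 (hsub hw)⟩).continuousAt
        continuous_norm.continuousAt).continuousWithinAt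
  obtain ⟨w, hw, hmin⟩ := (isCompact_closedBall (0 : ℂ) ‖z‖).exists_isMinOn ⟨0, by simp⟩ hucont
  rw [mem_closedBall_zero_iff] at hw
  have hmin' {v : ℂ} (hv : ‖v‖ ≤ ‖z‖) : u w ≤ u v := hmin (mem_closedBall_zero_iff.2 hv)
  suffices hw0 : w = 0 by
    have := hmin' le_rfl
    simp only [hu, hw0, norm_zero] at this
    linarith
  by_contra hw0
  have hwd : w ∈ disk := mem_disk.2 (hw.trans_lt (mem_disk.1 hz))
  have hQw := (hasDerivAt_of_mem_disk hQ hwd).differentiableAt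
  have him := im_id_mul_deriv_eq_zero_of_isMinOn_sphere hQw fun v hv => by
    rw [mem_sphere_zero_iff_norm] at hv
    simpa [hu, hv] using hmin' (hv.trans_le hw)
  have hlin : HasDerivAt (fun t : ℝ => t * ‖w‖) ‖w‖ 1 := by
    simpa using (hasDerivAt_id (1 : ℝ)).mul_const ‖w‖
  have hpw := (hp ‖w‖ ⟨norm_nonneg w, mem_disk.1 hwd⟩).comp_of_eq (1 : ℝ) hlin (one_mul _).symm
  refine not_forall_le_of_hasDerivAt_pos zero_lt_one ((hasDerivAt_re_radial hQw).sub hpw)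
    (by linarith [h w hwd hw0 him]) fun t ht => ?_
  have hn : ‖(t : ℂ) * w‖ = t * ‖w‖ := by
    rw [norm_mul, Complex.norm_real, Real.norm_of_nonneg ht.1.le]
  have := hmin' (hn.trans_le ((mul_le_of_le_one_left (norm_nonneg w) ht.2.le).trans hw))
  simp only [hu, hn] at this
  simpa using this

theorem le_re_of_radial_deriv_le (hQ : DifferentiableOn ℂ Q disk) {p p' : ℝ → ℝ}
    (hp : ∀ t ∈ Ico (0 : ℝ) 1, HasDerivAt p (p' t) t) (h0 : p 0 ≤ (Q 0).re)
    (h : ∀ w ∈ disk, (w * deriv Q w).im = 0 → ‖w‖ * p' ‖w‖ ≤ (w * deriv Q w).re) {z : ℂ}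
    (hz : z ∈ disk) : p ‖z‖ ≤ (Q z).re := by
  refine le_of_forall_pos_le_add fun ε hε => ?_
  have hlt := le_re_of_radial_deriv_lt hQ (p := fun t => p t - ε * t) (p' := fun t => p' t - ε)
    (fun t ht => ((hp t ht).sub ((hasDerivAt_id t).const_mul ε)).congr_deriv (by rw [mul_one]))
    (by simpa using h0) (fun w hw hw0 him => by
      linarith [h w hw him, mul_pos hε (norm_pos_iff.2 hw0)]) hz
  linarith [mul_le_of_le_one_right hε.le (mem_disk.1 hz).le]

end RadialComparison

theorem IsConvexExtremal.re_deriv_neg_le_norm_deriv {φ k f : ℂ → ℂ} (hφ : IsPositiveUnivalent φ)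
    (hk : IsConvexExtremal φ k) (hf : IsConvexClass φ f) {z : ℂ} (hz : z ∈ disk) :
    (deriv k ((-‖z‖ : ℝ) : ℂ)).re ≤ ‖deriv f z‖ := by
  obtain ⟨p, p', hp0, hp⟩ := hk.exists_real_log_deriv hφ
  obtain ⟨ω, Q, ⟨hω, hωd, hω0⟩, hQ, hQ0, hQφ, hfQ⟩ := hf.exists_log_deriv hφ.analytic hφ.map_zero
  have hneg {t : ℝ} (ht : t ∈ Ico (0 : ℝ) 1) : -t ∈ Ioo (-1 : ℝ) 1 :=
    ⟨by linarith [ht.2], by linarith [ht.1]⟩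
  have hnorm {w : ℂ} (hw : w ∈ disk) : ‖w‖ ∈ Ico (0 : ℝ) 1 := ⟨norm_nonneg w, mem_disk.1 hw⟩
  have hle : p (-‖z‖) ≤ (Q z).re := by
    refine le_re_of_radial_deriv_le hQ (p := fun t => p (-t)) (p' := fun t => -p' (-t))
      (fun t ht => ((hp _ (hneg ht)).1.comp t (hasDerivAt_neg t)).congr_deriv (by ring))
      (by simp [hp0, hQ0]) (fun w hw him => ?_) hz
    rw [hQφ w hw, Complex.sub_im, Complex.one_im, sub_zero] at him
    have hωw : ((ω w).re : ℂ) = ω w := Complex.ext rfl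
      (im_eq_zero_of_im_apply_eq_zero hφ.analytic hφ.im_coeff hφ.univalent (hωd hw) him).symm
    have hschwarz : |(ω w).re| ≤ ‖w‖ := (Complex.abs_re_le_norm _).trans <|
      Complex.norm_le_norm_of_mapsTo_ball hω (hωd.mono_right Metric.ball_subset_closedBall) hω0
        (mem_disk.1 hw)
    have hφle := hφ.strictMonoOn_re.monotoneOn (hneg (hnorm hw))
      (abs_lt.1 (hschwarz.trans_lt (mem_disk.1 hw))) (neg_le_of_abs_le hschwarz)
    simp only [hωw] at hφle
    rw [hQφ w hw, Complex.sub_re, Complex.one_re]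
    linarith [(hp _ (hneg (hnorm hw))).2.1]
  rw [(hp _ (hneg (hnorm hz))).2.2, hfQ z hz, Complex.norm_exp, Complex.ofReal_re]
  exact Real.exp_le_exp.2 hle

/-! ### Distance to the boundary of a univalent image -/

theorem exists_hasDerivAt_norm_le {E : Type*} [NormedAddCommGroup E] [InnerProductSpace ℝ E]
    {γ : ℝ → E} {γ' : E} {t : ℝ} (hγ : HasDerivAt γ γ' t) (h0 : γ t ≠ 0) :
    ∃ D ≤ ‖γ'‖, HasDerivAt (fun t => ‖γ t‖) D t := by
  have hpos := norm_pos_iff.2 h0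
  have h := hγ.norm_sq.sqrt (by positivity)
  simp only [Real.sqrt_sq (norm_nonneg _), mul_div_mul_left _ _ (two_ne_zero' ℝ)] at h
  refine ⟨_, ?_, h⟩
  rw [div_le_iff₀ hpos, mul_comm]
  exact real_inner_le_norm _ _

theorem antitoneOn_comp_norm_sub_mul {E : Type*} [NormedAddCommGroup E] [InnerProductSpace ℝ E]
    {K K' : ℝ → ℝ} (hK : ∀ t ∈ Ico (0 : ℝ) 1, HasDerivAt K (K' t) t)
    (hK' : ∀ t ∈ Ico (0 : ℝ) 1, 0 ≤ K' t)
    {γ γ' : ℝ → E} {a b c : ℝ} (hγ1 : ∀ t ∈ Icc a b, ‖γ t‖ < 1)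
    (hγ : ∀ t ∈ Icc a b, HasDerivAt γ (γ' t) t) (hγ0 : ∀ t ∈ Ioo a b, γ t ≠ 0)
    (hle : ∀ t ∈ Ioo a b, K' ‖γ t‖ * ‖γ' t‖ ≤ c) :
    AntitoneOn (fun t => K ‖γ t‖ - t * c) (Icc a b) := by
  have hnorm {t : ℝ} (ht : t ∈ Icc a b) : ‖γ t‖ ∈ Ico (0 : ℝ) 1 :=
    ⟨norm_nonneg _, hγ1 t ht⟩
  have hder (t : ℝ) (ht : t ∈ Ioo a b) :
      ∃ D ≤ 0, HasDerivAt (fun t : ℝ => K ‖γ t‖ - t * c) D t := by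
    have ht' := Ioo_subset_Icc_self ht
    obtain ⟨D, hDle, hD⟩ := exists_hasDerivAt_norm_le (hγ t ht') (hγ0 t ht)
    refine ⟨_, ?_, ((hK _ (hnorm ht')).comp t hD).sub ((hasDerivAt_id t).mul_const c)⟩
    rw [one_mul, sub_nonpos]
    exact (mul_le_mul_of_nonneg_left hDle (hK' _ (hnorm ht'))).trans (hle t ht)
  refine antitoneOn_of_deriv_nonpos (convex_Icc a b) (fun t ht => ?_) (fun t ht => ?_)
    fun t ht => ?_
  · exact ((ContinuousAt.comp (f := fun t => ‖γ t‖) (hK _ (hnorm ht)).continuousAt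
      (hγ t ht).continuousAt.norm).sub
      (continuousAt_id.mul continuousAt_const)).continuousWithinAt
  all_goals
    rw [interior_Icc] at ht
    obtain ⟨D, hD0, hD⟩ := hder t ht
  · exact hD.differentiableAt.differentiableWithinAt
  · rwa [hD.deriv]

section UnivalentImage

variable {f : ℂ → ℂ} (hf : DifferentiableOn ℂ f disk) (hd : ∀ z ∈ disk, deriv f z ≠ 0)
include hf hd

theorem isOpen_image {U : Set ℂ} (hU : IsOpen U) (hUd : U ⊆ disk) : IsOpen (f '' U) := by
  rw [isOpen_iff_mem_nhds]
  rintro _ ⟨z, hz, rfl⟩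
  rw [← (hf.analyticAt (disk_mem_nhds (hUd hz))).hasStrictDerivAt.map_nhds_eq (hd z (hUd hz))]
  exact image_mem_map (hU.mem_nhds hz)

variable (hinj : InjOn f disk)
include hinj

theorem hasDerivAt_invFunOn {z : ℂ} (hz : z ∈ disk) :
    HasDerivAt (Function.invFunOn f disk) (deriv f z)⁻¹ (f z) := by
  have hst := (hf.analyticAt (disk_mem_nhds hz)).hasStrictDerivAt
  refine (hst.to_local_left_inverse (hd z hz) ?_).hasDerivAt
  filter_upwards [disk_mem_nhds hz] with w hw using hinj.leftInvOn_invFunOn hw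

theorem image_disk_ne_univ : f '' disk ≠ univ := by
  -- Otherwise the inverse function is bounded and entire, against Liouville's theorem.
  intro huniv
  have hdiff : Differentiable ℂ (Function.invFunOn f disk) := fun v => by
    obtain ⟨z, hz, rfl⟩ : v ∈ f '' disk := huniv ▸ mem_univ v
    exact (hasDerivAt_invFunOn hf hd hinj hz).differentiableAt
  have hbdd : Bornology.IsBounded (range (Function.invFunOn f disk)) := by
    refine (Metric.isBounded_ball : Bornology.IsBounded disk).subset ?_
    rintro _ ⟨v, rfl⟩
    exact Function.invFunOn_mem (huniv ▸ mem_univ v : v ∈ f '' disk)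
  have hhalf : (1 / 2 : ℂ) ∈ disk := by rw [mem_disk]; norm_num
  have := hdiff.apply_eq_apply_of_bounded hbdd (f 0) (f (1 / 2))
  rw [hinj.leftInvOn_invFunOn zero_mem_disk, hinj.leftInvOn_invFunOn hhalf] at this
  norm_num at this

theorem mem_frontier_image_of_tendsto {ι : Type*} {l : Filter ι} [l.NeBot] {γ : ι → ℂ} {w : ℂ}
    (hγ : ∀ᶠ i in l, γ i ∈ disk) (hnorm : Tendsto (fun i => ‖γ i‖) l (𝓝 1))
    (hw : Tendsto (fun i => f (γ i)) l (𝓝 w)) : w ∈ frontier (f '' disk) := by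
  rw [(isOpen_image hf hd isOpen_disk subset_rfl).frontier_eq]
  refine ⟨mem_closure_of_tendsto hw (hγ.mono fun i hi => mem_image_of_mem f hi), ?_⟩
  rintro ⟨z, hz, rfl⟩
  obtain ⟨ρ, hzρ, hρ⟩ := exists_between (mem_disk.1 hz)
  have hsub : Metric.ball (0 : ℂ) ρ ⊆ disk := Metric.ball_subset_ball hρ.le
  have hmem : f '' Metric.ball 0 ρ ∈ 𝓝 (f z) :=
    (isOpen_image hf hd Metric.isOpen_ball hsub).mem_nhds
      (mem_image_of_mem f (mem_ball_zero_iff.2 hzρ))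
  obtain ⟨i, hid, hiρ, hρi⟩ := (hγ.and ((hw.eventually_mem hmem).and
    (hnorm.eventually_const_lt hρ))).exists
  rw [hinj.mem_image_iff hsub hid, mem_ball_zero_iff] at hiρ
  exact hiρ.not_gt hρi

variable (h0 : f 0 = 0) {K K' : ℝ → ℝ} (hK : ∀ t ∈ Ico (0 : ℝ) 1, HasDerivAt K (K' t) t)
  (hK0 : K 0 = 0) (hK' : ∀ t ∈ Ico (0 : ℝ) 1, 0 < K' t)
  (hfK : ∀ z ∈ disk, K' ‖z‖ ≤ ‖deriv f z‖)
include h0 hK hK0 hK' hfK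

theorem le_norm_of_segment_subset_image {z : ℂ} (hz : z ∈ disk)
    (hseg : ∀ t ∈ Icc (0 : ℝ) 1, (t : ℂ) * f z ∈ f '' disk) : K ‖z‖ ≤ ‖f z‖ := by
  rcases eq_or_ne z 0 with rfl | hz0
  · simp [hK0]
  have hfz : f z ≠ 0 := fun h => hz0 (hinj hz zero_mem_disk (h.trans h0.symm))
  set γ : ℝ → ℂ := fun t => Function.invFunOn f disk (t * f z) with hγ
  have hγd (t : ℝ) (ht : t ∈ Icc (0 : ℝ) 1) : γ t ∈ disk := Function.invFunOn_mem (hseg t ht)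
  have hfγ (t : ℝ) (ht : t ∈ Icc (0 : ℝ) 1) : f (γ t) = t * f z :=
    Function.invFunOn_eq (hseg t ht)
  have hder (t : ℝ) (ht : t ∈ Icc (0 : ℝ) 1) :
      HasDerivAt γ ((deriv f (γ t))⁻¹ * f z) t := by
    have hline : HasDerivAt (fun t : ℝ => (t : ℂ) * f z) (f z) t := by
      simpa using (hasDerivAt_id t).ofReal_comp.mul_const (f z)
    exact (hasDerivAt_invFunOn hf hd hinj (hγd t ht)).comp_of_eq t hline (hfγ t ht)
  have hne (t : ℝ) (ht : t ∈ Ioo (0 : ℝ) 1) : γ t ≠ 0 := fun h => by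
    simpa [h, h0, hfz, ht.1.ne'] using hfγ t (Ioo_subset_Icc_self ht)
  have hspeed (t : ℝ) (ht : t ∈ Ioo (0 : ℝ) 1) :
      K' ‖γ t‖ * ‖(deriv f (γ t))⁻¹ * f z‖ ≤ ‖f z‖ := by
    have hmem := hγd t (Ioo_subset_Icc_self ht)
    refine (mul_le_mul_of_nonneg_right (hfK _ hmem) (norm_nonneg _)).trans_eq ?_
    rw [← norm_mul, mul_inv_cancel_left₀ (hd _ hmem)]
  have h01 := antitoneOn_comp_norm_sub_mul hK (fun t ht => (hK' t ht).le)
    (fun t ht => mem_disk.1 (hγd t ht)) hder hne hspeed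
    (left_mem_Icc.2 zero_le_one) (right_mem_Icc.2 zero_le_one) zero_le_one
  have hγ0 : γ 0 = 0 := by simpa [hγ, h0] using hinj.leftInvOn_invFunOn zero_mem_disk
  have hγ1 : γ 1 = z := by simpa [hγ] using hinj.leftInvOn_invFunOn hz
  simpa [hγ0, hγ1, hK0] using h01

theorem le_boundaryDist_of_le_norm_deriv {R : ℝ} (hR : R ∈ Ico (0 : ℝ) 1) :
    K R ≤ boundaryDist f := by
  have hopen := isOpen_image hf hd isOpen_disk subset_rfl
  have h0mem : (0 : ℂ) ∈ f '' disk := ⟨0, zero_mem_disk, h0⟩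
  obtain ⟨y, hy, hdist⟩ :=
    exists_mem_frontier_infDist_compl_eq_dist h0mem (image_disk_ne_univ hf hd hinj)
  rw [dist_zero_left] at hdist
  have hynot : y ∉ f '' disk := (hopen.frontier_eq ▸ hy).2
  suffices hRy : K R ≤ ‖y‖ by
    refine (Metric.le_infDist ⟨y, hy⟩).2 fun v hv => ?_
    rw [h0]
    exact hRy.trans <| hdist.symm.trans_le <|
      Metric.infDist_le_dist_of_mem (hopen.frontier_eq ▸ hv).2
  by_contra! hlt
  have hball : Metric.ball 0 ‖y‖ ⊆ f '' disk := hdist ▸ Metric.ball_infDist_compl_subset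
  have hKmono : StrictMonoOn K (Ico 0 1) :=
    strictMonoOn_of_deriv_pos (convex_Ico 0 1)
      (fun t ht => (hK t ht).continuousAt.continuousWithinAt) fun t ht => by
        rw [(hK t (interior_subset ht)).deriv]
        exact hK' t (interior_subset ht)
  have hsub : Metric.closedBall (0 : ℂ) R ⊆ disk := Metric.closedBall_subset_ball hR.2
  have hclosed : IsClosed (f '' Metric.closedBall 0 R) :=
    ((isCompact_closedBall 0 R).image_of_continuousOn (hf.continuousOn.mono hsub)).isClosed
  have hball' : Metric.ball 0 ‖y‖ ⊆ f '' Metric.closedBall 0 R := fun w hw => by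
    obtain ⟨z, hz, rfl⟩ := hball hw
    rw [mem_ball_zero_iff] at hw
    refine mem_image_of_mem f (mem_closedBall_zero_iff.2 ?_)
    have hz' : K ‖z‖ ≤ ‖f z‖ := le_norm_of_segment_subset_image hf hd hinj h0 hK hK0 hK' hfK hz
      fun t ht => hball <| by
        rw [mem_ball_zero_iff, norm_mul, Complex.norm_real, Real.norm_of_nonneg ht.1]
        exact (mul_le_of_le_one_left (norm_nonneg _) ht.2).trans_lt hw
    exact ((hKmono.lt_iff_lt ⟨norm_nonneg z, mem_disk.1 hz⟩ hR).1
      (hz'.trans_lt (hw.trans hlt))).le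
  have hy0 : ‖y‖ ≠ 0 := norm_ne_zero_iff.2 fun h => hynot (h ▸ h0mem)
  have hyball : y ∈ closure (Metric.ball 0 ‖y‖) := by simp [closure_ball _ hy0]
  exact hynot (image_mono hsub (hclosed.closure_subset_iff.2 hball' hyball))

end UnivalentImage

/-! ### Coefficient bounds -/

theorem circleAverage_div_pow {f : ℂ → ℂ} (hf : DifferentiableOn ℂ f disk) (n : ℕ) {ρ : ℝ}
    (h0 : 0 < ρ) (h1 : ρ < 1) :
    Real.circleAverage (fun z => f z / z ^ n) 0 ρ = coeff f n := by
  have hdc : DiffContOnCl ℂ f (Metric.ball 0 ρ) :=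
    (hf.mono (Metric.closedBall_subset_ball h1)).diffContOnCl_ball subset_rfl
  have hcauchy := hdc.circleIntegral_one_div_sub_center_pow_smul h0 n
  have hfun : (fun z : ℂ => (z - 0)⁻¹ • (f z / z ^ n)) =
      fun z => (1 / (z - 0) ^ (n + 1)) • f z := by
    ext z
    simp only [sub_zero, smul_eq_mul, pow_succ]
    field_simp
  rw [Real.circleAverage_eq_circleIntegral h0.ne', coeff, hfun, hcauchy, smul_eq_mul, smul_eq_mul]
  field_simp [Complex.two_pi_I_ne_zero]

theorem re_circleAverage_nonneg {F : ℂ → ℂ} {c : ℂ} {R : ℝ}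
    (h : ∀ z ∈ Metric.sphere c |R|, 0 ≤ (F z).re) : 0 ≤ (Real.circleAverage F c R).re := by
  by_cases hF : CircleIntegrable F c R
  · rw [← Complex.reCLM_apply, ← Complex.reCLM.circleAverage_comp_comm hF]
    exact Real.circleAverage_nonneg_of_nonneg h
  · rw [Real.circleAverage.integral_undef hF, Complex.zero_re]

theorem conj_ofReal_norm_div (z : ℂ) : (starRingEnd ℂ) (‖z‖ / z) = z / ‖z‖ := by
  rcases eq_or_ne z 0 with rfl | hz
  · simp
  rw [map_div₀, Complex.conj_ofReal, div_eq_div_iff (by simpa using hz) (by simpa using hz),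
    Complex.mul_conj', sq]

theorem circleAverage_mul_one_sub_re {p : ℂ → ℂ} (hp : DifferentiableOn ℂ p disk) (u : ℂ) {n : ℕ}
    (hn : n ≠ 0) {ρ : ℝ} (h0 : 0 < ρ) (h1 : ρ < 1) :
    Real.circleAverage (fun z => p z * ((1 - (u * (ρ / z) ^ n).re : ℝ) : ℂ)) 0 ρ
      = p 0 - u * ρ ^ n / 2 * coeff p n := by
  have hsub : Metric.closedBall (0 : ℂ) |ρ| ⊆ disk := by
    rw [abs_of_pos h0]
    exact Metric.closedBall_subset_ball h1
  have hsph := Metric.sphere_subset_closedBall.trans hsub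
  have hnorm (z) (hz : z ∈ Metric.sphere (0 : ℂ) |ρ|) : ‖z‖ = ρ := by
    simpa [abs_of_pos h0] using hz
  have hne (z) (hz : z ∈ Metric.sphere (0 : ℂ) |ρ|) : z ≠ 0 :=
    norm_pos_iff.1 ((hnorm z hz).symm ▸ h0)
  -- On `|z| = ρ` the conjugate of `ρ / z` is `z / ρ`, so the integrand is the difference of an
  -- analytic function and a multiple of the integrand of Cauchy's formula.
  let A (z : ℂ) : ℂ := p z - (starRingEnd ℂ) u / (2 * ρ ^ n) * z ^ n * p z
  let B (z : ℂ) : ℂ := (u * ρ ^ n / 2) • (p z / z ^ n)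
  have hAB : EqOn (fun z => p z * ((1 - (u * (ρ / z) ^ n).re : ℝ) : ℂ)) (fun z => A z - B z)
      (Metric.sphere 0 |ρ|) := fun z hz => by
    have hconj : (starRingEnd ℂ) (u * (ρ / z) ^ n) = (starRingEnd ℂ) u * (z / ρ) ^ n := by
      rw [map_mul, map_pow, ← hnorm z hz, conj_ofReal_norm_div]
    have hadd := Complex.add_conj (u * (ρ / z) ^ n)
    rw [hconj, div_pow, div_pow] at hadd
    simp only [A, B, smul_eq_mul, div_pow]
    push_cast at hadd ⊢
    linear_combination p z / 2 * hadd
  have hA : DifferentiableOn ℂ A disk := hp.fun_sub (.fun_mul (by fun_prop) hp)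
  have hAint : CircleIntegrable A 0 ρ := (hA.continuousOn.mono hsph).circleIntegrable'
  have hBint : CircleIntegrable B 0 ρ := ContinuousOn.circleIntegrable'
    (((hp.continuousOn.mono hsph).div (by fun_prop) fun z hz =>
      pow_ne_zero n (hne z hz)).const_smul (u * (ρ : ℂ) ^ n / 2))
  rw [Real.circleAverage_congr_sphere hAB, Real.circleAverage_fun_sub hAint hBint,
    Real.circleAverage_fun_smul, circleAverage_div_pow hp n h0 h1,
    ((hA.mono hsub).diffContOnCl_ball subset_rfl).circleAverage, smul_eq_mul]
  simp [A, hn]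

theorem norm_coeff_mul_pow_le_of_re_nonneg {p : ℂ → ℂ} (hp : DifferentiableOn ℂ p disk)
    (hre : ∀ z ∈ disk, 0 ≤ (p z).re) {n : ℕ} (hn : n ≠ 0) {ρ : ℝ} (h0 : 0 < ρ) (h1 : ρ < 1) :
    ‖coeff p n‖ * ρ ^ n ≤ 2 * (p 0).re := by
  obtain ⟨u, hu, hup⟩ := RCLike.exists_norm_eq_mul_self (coeff p n)
  have havg := circleAverage_mul_one_sub_re hp u hn h0 h1
  have hval : p 0 - u * ρ ^ n / 2 * coeff p n
      = p 0 - ((‖coeff p n‖ * ρ ^ n / 2 : ℝ) : ℂ) := by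
    push_cast
    linear_combination ((ρ : ℂ) ^ n / 2) * hup
  have hpos : 0 ≤ (Real.circleAverage
      (fun z => p z * ((1 - (u * (ρ / z) ^ n).re : ℝ) : ℂ)) 0 ρ).re := by
    refine re_circleAverage_nonneg fun z hz => ?_
    have hz : ‖z‖ = ρ := by simpa [abs_of_pos h0] using hz
    have hw : (u * (ρ / z) ^ n).re ≤ 1 := (Complex.re_le_norm _).trans_eq
      (by simp [hu, hz, h0.ne', abs_of_pos h0])
    rw [Complex.re_mul_ofReal]
    exact mul_nonneg (hre z (by rwa [mem_disk, hz])) (by linarith)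
  rw [havg, hval, Complex.sub_re, Complex.ofReal_re] at hpos
  linarith

theorem norm_coeff_le_of_re_nonneg {p : ℂ → ℂ} (hp : DifferentiableOn ℂ p disk)
    (hre : ∀ z ∈ disk, 0 ≤ (p z).re) {n : ℕ} (hn : n ≠ 0) : ‖coeff p n‖ ≤ 2 * (p 0).re := by
  have hlim : Tendsto (fun ρ : ℝ => ‖coeff p n‖ * ρ ^ n) (𝓝[<] 1) (𝓝 ‖coeff p n‖) := by
    have hcont : Continuous fun ρ : ℝ => ‖coeff p n‖ * ρ ^ n := by fun_prop
    simpa using (hcont.tendsto 1).mono_left nhdsWithin_le_nhds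
  refine le_of_tendsto hlim ?_
  filter_upwards [Ioo_mem_nhdsLT (zero_lt_one' ℝ)] with ρ hρ
  exact norm_coeff_mul_pow_le_of_re_nonneg hp hre hn hρ.1 hρ.2

theorem coeff_const_mul (c : ℂ) (f : ℂ → ℂ) (n : ℕ) :
    coeff (fun z => c * f z) n = c * coeff f n := by
  rw [coeff, coeff, iteratedDeriv_const_mul_field, mul_div_assoc]

theorem coeff_const_sub (c : ℂ) (f : ℂ → ℂ) {n : ℕ} (hn : n ≠ 0) :
    coeff (fun z => c - f z) n = -coeff f n := by
  rw [coeff, coeff, iteratedDeriv_const_sub hn.bot_lt, iteratedDeriv_neg, neg_div]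

theorem norm_coeff_le_of_norm_le_one {f : ℂ → ℂ} (hf : DifferentiableOn ℂ f disk)
    (hb : ∀ z ∈ disk, ‖f z‖ ≤ 1) {n : ℕ} (hn : n ≠ 0) : ‖coeff f n‖ ≤ 2 * (1 - ‖f 0‖) := by
  obtain ⟨u, hu, huf⟩ := RCLike.exists_norm_eq_mul_self (f 0)
  have hre (z) (hz : z ∈ disk) : 0 ≤ (1 - u * f z).re := by
    have hle : (u * f z).re ≤ ‖f z‖ :=
      (Complex.re_le_norm _).trans_eq (by rw [norm_mul, hu, one_mul])
    simpa using hle.trans (hb z hz)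
  have h := norm_coeff_le_of_re_nonneg ((hf.const_mul u).const_sub 1) hre hn
  rw [coeff_const_sub _ _ hn, coeff_const_mul, norm_neg, norm_mul, hu, one_mul, Complex.sub_re,
    ← huf] at h
  simpa using h

/-! ### Majorant series and Bohr's theorem -/

/-- The full majorant series `∑ |a_n| r^n` of `f(z) = ∑ a_n z^n`, including the terms `n = 0, 1`
that `majorant` treats separately. -/
noncomputable def absSum (f : ℂ → ℂ) (r : ℝ) : ℝ := ∑' n, ‖coeff f n‖ * r ^ n

theorem absSum_congr {f g : ℂ → ℂ} (h : EqOn f g disk) : absSum f = absSum g := by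
  ext r
  simp only [absSum, coeff_congr h]

theorem absSum_nonneg (f : ℂ → ℂ) {r : ℝ} (hr : 0 ≤ r) : 0 ≤ absSum f r :=
  tsum_nonneg fun n => by positivity

theorem absSum_zero (f : ℂ → ℂ) : absSum f 0 = ‖f 0‖ := by
  rw [absSum, tsum_eq_single 0 fun n hn => by simp [hn]]
  simp [coeff_zero]

theorem absSum_one (r : ℝ) : absSum (fun _ => 1) r = 1 := by
  rw [absSum, tsum_eq_single 0 fun n hn => by simp [coeff, iteratedDeriv_const, hn]]
  simp [coeff_zero]

theorem absSum_const_mul (c : ℂ) (f : ℂ → ℂ) (r : ℝ) :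
    absSum (fun z => c * f z) r = ‖c‖ * absSum f r := by
  simp only [absSum, coeff_const_mul, norm_mul, mul_assoc, tsum_mul_left]

section Submultiplicativity

variable {f g : ℂ → ℂ} (hf : DifferentiableOn ℂ f disk) {r : ℝ} (h0 : 0 ≤ r) (h1 : r < 1)
include hf h0 h1

theorem absSum_mul_le (hg : DifferentiableOn ℂ g disk) :
    absSum (fun z => f z * g z) r ≤ absSum f r * absSum g r := by
  have hF := (summable_norm_coeff hf h0 h1).norm
  have hG := (summable_norm_coeff hg h0 h1).norm
  rw [absSum, absSum, absSum, tsum_mul_tsum_eq_tsum_sum_antidiagonal_of_summable_norm hF hG]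
  refine Summable.tsum_le_tsum (fun n => ?_) (summable_norm_coeff (hf.fun_mul hg) h0 h1)
    (summable_norm_sum_mul_antidiagonal_of_summable_norm hF hG).of_norm
  rw [coeff_mul hf hg]
  refine (mul_le_mul_of_nonneg_right (norm_sum_le _ _) (by positivity)).trans_eq ?_
  rw [Finset.sum_mul]
  refine Finset.sum_congr rfl fun p hp => ?_
  rw [← Finset.HasAntidiagonal.mem_antidiagonal.1 hp, pow_add, norm_mul]
  ring

theorem absSum_pow_le (n : ℕ) : absSum (fun z => f z ^ n) r ≤ absSum f r ^ n := by
  induction n with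
  | zero => simp only [pow_zero, absSum_one, le_refl]
  | succ n ih =>
    simp only [pow_succ]
    exact (absSum_mul_le (hf.fun_pow n) h0 h1 hf).trans
      (mul_le_mul_of_nonneg_right ih (absSum_nonneg f h0))

theorem absSum_id_mul : absSum (fun z => z * f z) r = r * absSum f r := by
  have hd : DifferentiableOn ℂ (fun z => z * f z) disk := differentiableOn_id.fun_mul hf
  rw [absSum, (summable_norm_coeff hd h0 h1).tsum_eq_zero_add, absSum, ← tsum_mul_left]
  simp only [coeff_zero, zero_mul, norm_zero, zero_add, coeff_id_mul_succ hf, pow_succ]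
  exact tsum_congr fun n => by ring

end Submultiplicativity

theorem absSum_le_tsum_absSum {F : ℕ → ℂ → ℂ} {g : ℂ → ℂ}
    (hF : ∀ n, DifferentiableOn ℂ (F n) disk) (hg : DifferentiableOn ℂ g disk) {r : ℝ}
    (h0 : 0 < r) (h1 : r < 1) (hFg : ∀ z, ‖z‖ < r → HasSum (fun n => F n z) (g z))
    (hsum : Summable fun n => absSum (F n) r) : absSum g r ≤ ∑' n, absSum (F n) r := by
  have hrow (n) := (summable_norm_coeff (hF n) h0.le h1).hasSum
  have hprod : Summable fun p : ℕ × ℕ => ‖coeff (F p.1) p.2‖ * r ^ p.2 :=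
    (summable_prod_of_nonneg fun p => by positivity).2 ⟨fun n => (hrow n).summable, hsum⟩
  have hcol (m) : Summable fun n => ‖coeff (F n) m‖ :=
    (summable_mul_right_iff (pow_ne_zero m h0.ne')).1 (hprod.prod_symm.prod_factor m)
  have hcoeff : coeff g = fun m => ∑' n, coeff (F n) m := by
    refine coeff_eq_of_hasSum ?_
    filter_upwards [Metric.ball_mem_nhds (0 : ℂ) h0] with z hz
    rw [mem_ball_zero_iff] at hz
    have hdouble : Summable fun p : ℕ × ℕ => coeff (F p.1) p.2 * z ^ p.2 := by
      refine Summable.of_norm_bounded hprod fun p => ?_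
      rw [norm_mul, norm_pow]
      gcongr
    have hrows : HasSum (fun p : ℕ × ℕ => coeff (F p.1) p.2 * z ^ p.2) (g z) := by
      have h := hdouble.hasSum.prod_fiberwise fun n =>
        hasSum_coeff (hF n) (mem_disk.2 (hz.trans h1))
      exact (hFg z hz).unique h ▸ hdouble.hasSum
    exact ((Equiv.prodComm ℕ ℕ).hasSum_iff.2 hrows).prod_fiberwise fun m =>
      (hcol m).of_norm.hasSum.mul_right (z ^ m)
  calc absSum g r ≤ ∑' m, ∑' n, ‖coeff (F n) m‖ * r ^ m := by
        refine Summable.tsum_le_tsum (fun m => ?_) (summable_norm_coeff hg h0.le h1)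
          hprod.prod_symm.prod
        rw [hcoeff, tsum_mul_right]
        exact mul_le_mul_of_nonneg_right (norm_tsum_le_tsum_norm (hcol m)) (by positivity)
    _ = ∑' n, absSum (F n) r :=
        (Summable.tsum_comm (f := fun m n => ‖coeff (F n) m‖ * r ^ m) hprod.prod_symm).symm

theorem absSum_comp_le {s ω : ℂ → ℂ} (hs : DifferentiableOn ℂ s disk)
    (hω : DifferentiableOn ℂ ω disk) (hωd : MapsTo ω disk disk) (hω0 : ω 0 = 0) {r : ℝ}
    (h0 : 0 ≤ r) (h1 : r < 1) (hr : absSum ω r ≤ r) :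
    absSum (fun z => s (ω z)) r ≤ absSum s r := by
  rcases h0.eq_or_lt with rfl | hpos
  · rw [absSum_zero, absSum_zero, hω0]
  have hterm (n : ℕ) : absSum (fun z => coeff s n * ω z ^ n) r ≤ ‖coeff s n‖ * r ^ n := by
    rw [absSum_const_mul]
    have hpow := (absSum_pow_le hω h0 h1 n).trans (pow_le_pow_left₀ (absSum_nonneg ω h0) hr n)
    exact mul_le_mul_of_nonneg_left hpow (norm_nonneg _)
  have hs' := summable_norm_coeff hs h0 h1
  have hsum := Summable.of_nonneg_of_le (fun n => absSum_nonneg _ h0) hterm hs'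
  exact (absSum_le_tsum_absSum (fun n => (hω.fun_pow n).const_mul _) (hs.comp hω hωd) hpos h1
    (fun z hz => hasSum_coeff hs (hωd (mem_disk.2 (hz.trans h1)))) hsum).trans
    (hsum.tsum_le_tsum hterm hs')

/-- **Bohr's theorem**. -/
theorem absSum_le_one {f : ℂ → ℂ} (hf : DifferentiableOn ℂ f disk)
    (hb : ∀ z ∈ disk, ‖f z‖ ≤ 1) {r : ℝ} (h0 : 0 ≤ r) (h1 : r ≤ 1 / 3) : absSum f r ≤ 1 := by
  have hr1 : r < 1 := by linarith
  have hs := summable_norm_coeff hf h0 hr1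
  have hgeo := (hasSum_geometric_of_lt_one h0 hr1).mul_left (2 * (1 - ‖f 0‖) * r)
  have htail : ∑' n, ‖coeff f (n + 1)‖ * r ^ (n + 1) ≤ 2 * (1 - ‖f 0‖) * r * (1 - r)⁻¹ := by
    rw [← hgeo.tsum_eq]
    refine Summable.tsum_le_tsum (fun n => ?_) ((summable_nat_add_iff 1).2 hs) hgeo.summable
    rw [pow_succ', mul_assoc (2 * _)]
    exact mul_le_mul_of_nonneg_right (norm_coeff_le_of_norm_le_one hf hb n.succ_ne_zero)
      (by positivity)
  have hratio : r * (1 - r)⁻¹ ≤ 1 / 2 := by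
    rw [← div_eq_mul_inv, div_le_iff₀ (by linarith)]
    linarith
  rw [absSum, hs.tsum_eq_zero_add, coeff_zero, pow_zero, mul_one]
  nlinarith [hb 0 zero_mem_disk]

theorem absSum_le_self_of_mapsTo {ω : ℂ → ℂ} (hω : DifferentiableOn ℂ ω disk)
    (hωd : MapsTo ω disk disk) (hω0 : ω 0 = 0) {r : ℝ} (h0 : 0 ≤ r) (h1 : r ≤ 1 / 3) :
    absSum ω r ≤ r := by
  have hd : DifferentiableOn ℂ (dslope ω 0) disk :=
    (Complex.differentiableOn_dslope (disk_mem_nhds zero_mem_disk)).2 hω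
  have hschwarz : ∀ z ∈ disk, ‖dslope ω 0 z‖ ≤ 1 := fun z hz => by
    simpa using Complex.norm_dslope_le_div_of_mapsTo_ball (R₂ := 1) hω
      (by rw [hω0]; exact hωd.mono_right Metric.ball_subset_closedBall) hz
  have hfactor : EqOn ω (fun z => z * dslope ω 0 z) disk := fun z _ => by
    simpa [hω0] using (sub_smul_dslope ω 0 z).symm
  rw [absSum_congr hfactor, absSum_id_mul hd h0 (by linarith)]
  exact mul_le_of_le_one_right h0 (absSum_le_one hd hschwarz h0 h1)

/-! ### Comparison of majorant series -/

theorem hasDerivAt_absSum {f : ℂ → ℂ} (hf : DifferentiableOn ℂ f disk) {t : ℝ} (ht : |t| < 1) :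
    HasDerivAt (absSum f) (absSum (deriv f) t) t := by
  obtain ⟨ρ, htρ, hρ⟩ := exists_between ht
  have hρ0 : 0 < ρ := (abs_nonneg t).trans_lt htρ
  have hnorm (n : ℕ) : ‖coeff (deriv f) n‖ = ‖coeff f (n + 1)‖ * (n + 1 : ℕ) := by
    rw [coeff_deriv, norm_mul, mul_comm, ← Nat.cast_succ, Complex.norm_natCast]
  have hsum : Summable fun n : ℕ => ‖coeff f n‖ * (n * ρ ^ (n - 1)) := by
    rw [← summable_nat_add_iff 1]
    refine (summable_norm_coeff (hf.deriv isOpen_disk) hρ0.le hρ).congr fun n => ?_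
    rw [hnorm, Nat.add_sub_cancel, mul_assoc]
  have hbound (n : ℕ) (y) (hy : y ∈ Ioo (-ρ) ρ) : ‖‖coeff f n‖ * (n * y ^ (n - 1))‖
      ≤ ‖coeff f n‖ * (n * ρ ^ (n - 1)) := by
    have hy' : |y| ≤ ρ := (abs_lt.2 hy).le
    rw [norm_mul, norm_mul, norm_pow, norm_norm, Real.norm_natCast, Real.norm_eq_abs]
    gcongr
  have ht' : t ∈ Ioo (-ρ) ρ := abs_lt.1 htρ
  refine (hasDerivAt_tsum_of_isPreconnected (g := fun n y => ‖coeff f n‖ * y ^ n) hsum isOpen_Ioo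
    isPreconnected_Ioo (fun n y _ => (hasDerivAt_pow n y).const_mul _) hbound
    (show (0 : ℝ) ∈ Ioo (-ρ) ρ from ⟨neg_lt_zero.2 hρ0, hρ0⟩)
    (summable_norm_coeff hf le_rfl zero_lt_one) ht').congr_deriv ?_
  rw [(Summable.of_norm_bounded hsum fun n => hbound n t ht').tsum_eq_zero_add, absSum]
  simp only [Nat.cast_zero, zero_mul, mul_zero, zero_add, Nat.add_sub_cancel, hnorm, mul_assoc]

theorem absSum_le_of_absSum_deriv_le {f g : ℂ → ℂ} (hf : DifferentiableOn ℂ f disk)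
    (hg : DifferentiableOn ℂ g disk) (h0 : ‖f 0‖ ≤ ‖g 0‖) {r : ℝ} (hr0 : 0 ≤ r) (hr : r < 1)
    (hle : ∀ t ∈ Icc 0 r, absSum (deriv f) t ≤ absSum (deriv g) t) :
    absSum f r ≤ absSum g r := by
  have habs (t) (ht : t ∈ Icc 0 r) : |t| < 1 := (abs_of_nonneg ht.1).trans_lt (ht.2.trans_lt hr)
  have hf' (t) (ht : t ∈ Icc 0 r) := hasDerivAt_absSum hf (habs t ht)
  have hg' (t) (ht : t ∈ Icc 0 r) := hasDerivAt_absSum hg (habs t ht)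
  exact image_le_of_deriv_right_le_deriv_boundary (HasDerivAt.continuousOn hf')
    (fun t ht => (hf' t (Ico_subset_Icc_self ht)).hasDerivWithinAt)
    (by rwa [absSum_zero, absSum_zero]) (HasDerivAt.continuousOn hg')
    (fun t ht => (hg' t (Ico_subset_Icc_self ht)).hasDerivWithinAt)
    (fun t ht => hle t (Ico_subset_Icc_self ht)) (right_mem_Icc.2 hr0)

theorem absSum_eq_apply_of_coeff_nonneg {f : ℂ → ℂ} (hf : DifferentiableOn ℂ f disk)
    (hn : ∀ n, 0 ≤ coeff f n) {t : ℝ} (h0 : 0 ≤ t) (h1 : t < 1) : (absSum f t : ℂ) = f t := by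
  have ht : (t : ℂ) ∈ disk := by simpa [mem_disk, abs_of_nonneg h0] using h1
  rw [absSum, Complex.ofReal_tsum, ← (hasSum_coeff hf ht).tsum_eq]
  refine tsum_congr fun n => ?_
  rw [Complex.ofReal_mul, Complex.ofReal_pow, ← Complex.eq_coe_norm_of_nonneg (hn n)]

theorem norm_apply_zero_le_absSum {f : ℂ → ℂ} (hf : DifferentiableOn ℂ f disk) {t : ℝ}
    (h0 : 0 ≤ t) (h1 : t < 1) : ‖f 0‖ ≤ absSum f t := by
  simpa [coeff_zero, absSum] using
    (summable_norm_coeff hf h0 h1).le_tsum 0 fun n _ => by positivity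

section EulerEquation

variable {f p : ℂ → ℂ} (hf : DifferentiableOn ℂ f disk) (hp : DifferentiableOn ℂ p disk)
  (hfp : ∀ z ∈ disk, z * deriv f z = p z * f z)
include hf hp hfp

theorem mul_absSum_deriv_le {t : ℝ} (h0 : 0 ≤ t) (h1 : t < 1) :
    t * absSum (deriv f) t ≤ absSum p t * absSum f t := by
  rw [← absSum_id_mul (hf.deriv isOpen_disk) h0 h1, absSum_congr hfp]
  exact absSum_mul_le hp h0 h1 hf

variable (hp0 : ∀ n, 0 ≤ coeff p n)
include hp0

theorem mul_absSum_deriv_eq (hf0 : ∀ n, 0 ≤ coeff f n) {t : ℝ} (h0 : 0 ≤ t) (h1 : t < 1) :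
    t * absSum (deriv f) t = absSum p t * absSum f t := by
  have hn (n) : 0 ≤ coeff (fun z => p z * f z) n := by
    rw [coeff_mul hp hf]
    exact Finset.sum_nonneg fun q _ => mul_nonneg (hp0 _) (hf0 _)
  rw [← absSum_id_mul (hf.deriv isOpen_disk) h0 h1, absSum_congr hfp, ← Complex.ofReal_inj,
    Complex.ofReal_mul, absSum_eq_apply_of_coeff_nonneg (hp.fun_mul hf) hn h0 h1,
    absSum_eq_apply_of_coeff_nonneg hp hp0 h0 h1, absSum_eq_apply_of_coeff_nonneg hf hf0 h0 h1]

theorem coeff_nonneg_of_id_mul_deriv_eq (hpz : p 0 = 0) (hfz : 0 ≤ f 0) (n : ℕ) :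
    0 ≤ coeff f n := by
  induction n using Nat.strong_induction_on with
  | _ n ih =>
    rcases Nat.eq_zero_or_pos n with rfl | hpos
    · rwa [coeff_zero]
    have hrec : n * coeff f n
        = ∑ q ∈ Finset.HasAntidiagonal.antidiagonal n, coeff p q.1 * coeff f q.2 := by
      rw [← coeff_id_mul_deriv hf, coeff_congr hfp, coeff_mul hp hf]
    have hsum : 0 ≤ (n : ℂ) * coeff f n := by
      rw [hrec]
      refine Finset.sum_nonneg fun q hq => ?_
      rw [Finset.HasAntidiagonal.mem_antidiagonal] at hq
      rcases Nat.eq_zero_or_pos q.1 with h0 | h0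
      · rw [h0, coeff_zero, hpz, zero_mul]
      · exact mul_nonneg (hp0 _) (ih _ (by omega))
    exact le_of_mul_le_mul_left (by simpa using hsum) (Nat.cast_pos.2 hpos)

end EulerEquation

theorem antitoneOn_div_of_deriv_mul_le {u v u' v' : ℝ → ℝ} {D : Set ℝ} (hD : Convex ℝ D)
    (hu : ∀ t ∈ D, HasDerivAt u (u' t) t) (hv : ∀ t ∈ D, HasDerivAt v (v' t) t)
    (hv0 : ∀ t ∈ D, 0 < v t) (h : ∀ t ∈ interior D, u' t * v t ≤ u t * v' t) :
    AntitoneOn (fun t => u t / v t) D := by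
  have hder (t) (ht : t ∈ D) := (hu t ht).div (hv t ht) (hv0 t ht).ne'
  refine antitoneOn_of_hasDerivWithinAt_nonpos hD (HasDerivAt.continuousOn hder)
    (fun t ht => (hder t (interior_subset ht)).hasDerivWithinAt) fun t ht => ?_
  exact div_nonpos_of_nonpos_of_nonneg (sub_nonpos.2 (h t ht)) (sq_nonneg _)

/-- Passing to majorants, `z f' = p f` and `z g' = q g` make the logarithmic derivative of the
majorant of `f` at most that of the majorant of `g`. -/
theorem absSum_le_of_id_mul_deriv_eq {f g p q : ℂ → ℂ} (hf : DifferentiableOn ℂ f disk)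
    (hg : DifferentiableOn ℂ g disk) (hp : DifferentiableOn ℂ p disk)
    (hq : DifferentiableOn ℂ q disk) (hfp : ∀ z ∈ disk, z * deriv f z = p z * f z)
    (hgq : ∀ z ∈ disk, z * deriv g z = q z * g z) (hq0 : ∀ n, 0 ≤ coeff q n) (hqz : q 0 = 0)
    (hgz : 0 < g 0) (hfg : ‖f 0‖ ≤ ‖g 0‖) {r : ℝ} (hr : r < 1)
    (hpq : ∀ t ∈ Icc 0 r, absSum p t ≤ absSum q t) {t : ℝ} (ht : t ∈ Icc 0 r) :
    absSum f t ≤ absSum g t := by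
  have hlt (t) (ht : t ∈ Icc 0 r) : t < 1 := ht.2.trans_lt hr
  have habs (t) (ht : t ∈ Icc 0 r) : |t| < 1 := (abs_of_nonneg ht.1).trans_lt (hlt t ht)
  have hg0 := coeff_nonneg_of_id_mul_deriv_eq hg hq hgq hq0 hqz hgz.le
  have hpos (t) (ht : t ∈ Icc 0 r) : 0 < absSum g t :=
    (norm_pos_iff.2 hgz.ne').trans_le (norm_apply_zero_le_absSum hg ht.1 (hlt t ht))
  have hanti := antitoneOn_div_of_deriv_mul_le (convex_Icc 0 r)
    (fun t ht => hasDerivAt_absSum hf (habs t ht)) (fun t ht => hasDerivAt_absSum hg (habs t ht))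
    hpos fun t ht => by
      rw [interior_Icc] at ht
      have htI := Ioo_subset_Icc_self ht
      refine le_of_mul_le_mul_left ?_ ht.1
      calc t * (absSum (deriv f) t * absSum g t)
          = t * absSum (deriv f) t * absSum g t := by ring
        _ ≤ absSum q t * absSum f t * absSum g t := by
            refine mul_le_mul_of_nonneg_right ?_ (hpos t htI).le
            exact (mul_absSum_deriv_le hf hp hfp ht.1.le (hlt t htI)).trans
              (mul_le_mul_of_nonneg_right (hpq t htI) (absSum_nonneg f ht.1.le))
        _ = t * (absSum f t * absSum (deriv g) t) := by
            linear_combination (-absSum f t) *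
              mul_absSum_deriv_eq hg hq hgq hq0 hg0 ht.1.le (hlt t htI)
  have hratio : absSum f t / absSum g t ≤ 1 := (hanti ⟨le_rfl, ht.1.trans ht.2⟩ ht ht.1).trans
    (by simpa only [absSum_zero] using div_le_one_of_le₀ hfg (norm_nonneg _))
  exact (div_le_one (hpos t ht)).1 hratio

theorem IsUnivalentNormalized.majorant_eq_absSum {f : ℂ → ℂ} (hf : IsUnivalentNormalized f)
    {r : ℝ} (h0 : 0 ≤ r) (h1 : r < 1) : majorant f r = absSum f r := by
  rw [majorant, absSum, ← (summable_norm_coeff hf.analytic h0 h1).sum_add_tsum_nat_add 2]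
  simp [Finset.sum_range_succ, coeff_zero, coeff_one, hf.map_zero, hf.deriv_zero]

/-! ### The extremal function -/

theorem IsPositiveUnivalent.coeff_sub_one_nonneg {φ : ℂ → ℂ} (hφ : IsPositiveUnivalent φ) (n : ℕ) :
    0 ≤ coeff (fun z => φ z - 1) n := by
  cases n with
  | zero => rw [coeff_zero, hφ.map_zero, sub_self]
  | succ n =>
    have h := hφ.coeff_nonneg (n + 1)
    simpa only [coeff, iteratedDeriv_succ', deriv_sub_const_fun] using h

/-- The function `t ↦ -k(-t)`, the lower growth bound for `C(φ)`. Only the real part is kept; `k` is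
real on the real axis when it is extremal for a `φ` with real coefficients. -/
noncomputable def growth (k : ℂ → ℂ) (t : ℝ) : ℝ := -(k ((-t : ℝ) : ℂ)).re

/-- The number `-k(-1)`, the analogue of the Koebe constant for `C(φ)`. It is encoded as a supremum,
which is the radial limit of `growth k` because this function increases. -/
noncomputable def koebeRadius (k : ℂ → ℂ) : ℝ := sSup (growth k '' Ioo 0 1)

theorem Ico_zero_one_subset_Ioo : Ico (0 : ℝ) 1 ⊆ Ioo (-1) 1 :=
  Ico_subset_Ioo_left neg_one_lt_zero

theorem koebeRadius_le {k : ℂ → ℂ} {x : ℝ} (hx : ∀ t ∈ Ioo (0 : ℝ) 1, growth k t ≤ x) :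
    koebeRadius k ≤ x :=
  csSup_le ((nonempty_Ioo.2 zero_lt_one).image _) (forall_mem_image.2 hx)

theorem IsUnivalentNormalized.growth_zero {k : ℂ → ℂ} (hk : IsUnivalentNormalized k) :
    growth k 0 = 0 := by
  simp [growth, hk.map_zero]

theorem IsUnivalentNormalized.hasDerivAt_growth {k : ℂ → ℂ} (hk : IsUnivalentNormalized k) {t : ℝ}
    (ht : t ∈ Ioo (-1 : ℝ) 1) : HasDerivAt (growth k) (deriv k ((-t : ℝ) : ℂ)).re t := by
  have hneg : ((-t : ℝ) : ℂ) ∈ disk := ofReal_mem_disk ⟨by linarith [ht.2], by linarith [ht.1]⟩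
  exact ((hasDerivAt_of_mem_disk hk.analytic hneg).real_of_complex.comp t
    (hasDerivAt_neg t)).neg.congr_deriv (by ring)

namespace IsConvexExtremal

variable {φ k : ℂ → ℂ} (hφ : IsPositiveUnivalent φ) (hk : IsConvexExtremal φ k)
include hφ hk

theorem coeff_deriv_nonneg (n : ℕ) : 0 ≤ coeff (deriv k) n :=
  coeff_nonneg_of_id_mul_deriv_eq (hk.1.analytic.deriv isOpen_disk) (hφ.analytic.sub_const 1)
    (fun _ hz => hk.1.id_mul_deriv_deriv_eq hφ.analytic hk.2 hz) hφ.coeff_sub_one_nonneg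
    (by rw [hφ.map_zero, sub_self]) (by simp [hk.1.deriv_zero]) n

theorem coeff_nonneg (n : ℕ) : 0 ≤ coeff k n := by
  cases n with
  | zero => rw [coeff_zero, hk.1.map_zero]
  | succ n =>
    have h := hk.coeff_deriv_nonneg hφ n
    rw [coeff_deriv] at h
    exact le_of_mul_le_mul_left (by simpa using h) (by exact_mod_cast n.succ_pos)

theorem apply_ofReal {t : ℝ} (h0 : 0 ≤ t) (h1 : t < 1) : k t = (absSum k t : ℂ) :=
  (absSum_eq_apply_of_coeff_nonneg hk.1.analytic (hk.coeff_nonneg hφ) h0 h1).symm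

theorem apply_neg {t : ℝ} (ht : t ∈ Ioo (-1 : ℝ) 1) : k (-(t : ℂ)) = -(growth k t : ℂ) := by
  have him : (k ((-t : ℝ) : ℂ)).im = 0 := im_apply_ofReal_of_real_coeff hk.1.analytic
    (fun n => (Complex.nonneg_iff.1 (hk.coeff_nonneg hφ n)).2.symm)
    (by rw [abs_neg]; exact abs_lt.2 ht)
  rw [← Complex.ofReal_neg, ← Complex.ofReal_neg, growth, neg_neg]
  exact Complex.ext rfl him

theorem strictMonoOn_growth : StrictMonoOn (growth k) (Ico 0 1) := by
  have hder (t) (ht : t ∈ Ico (0 : ℝ) 1) := hk.1.hasDerivAt_growth (Ico_zero_one_subset_Ioo ht)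
  refine strictMonoOn_of_hasDerivWithinAt_pos (convex_Ico 0 1) (HasDerivAt.continuousOn hder)
    (fun t ht => (hder t (interior_subset ht)).hasDerivWithinAt) fun t ht => ?_
  rw [interior_Ico] at ht
  exact hk.re_deriv_ofReal_pos hφ ⟨by linarith [ht.2], by linarith [ht.1]⟩

theorem strictMonoOn_sub_growth : StrictMonoOn (fun t => t - growth k t) (Ico 0 1) := by
  have hder (t) (ht : t ∈ Ico (0 : ℝ) 1) :=
    (hasDerivAt_id t).sub (hk.1.hasDerivAt_growth (Ico_zero_one_subset_Ioo ht))
  refine strictMonoOn_of_hasDerivWithinAt_pos (convex_Ico 0 1) (HasDerivAt.continuousOn hder)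
    (fun t ht => (hder t (interior_subset ht)).hasDerivWithinAt) fun t ht => ?_
  rw [interior_Ico] at ht
  exact sub_pos.2 (hk.re_deriv_ofReal_lt_one hφ ⟨by linarith [ht.2], by linarith [ht.1]⟩)

theorem growth_le {t : ℝ} (ht : t ∈ Ioo (0 : ℝ) 1) :
    growth k t ≤ 1 - (1 / 2 - growth k (1 / 2)) := by
  have hhalf : (1 / 2 : ℝ) ∈ Ico (0 : ℝ) 1 := by norm_num
  have ht' := Ioo_subset_Ico_self ht
  rcases le_total t (1 / 2) with hle | hle
  · have := (hk.strictMonoOn_growth hφ).monotoneOn ht' hhalf hle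
    linarith
  · have := (hk.strictMonoOn_sub_growth hφ).monotoneOn hhalf ht' hle
    linarith [ht.2]

theorem bddAbove_growth : BddAbove (growth k '' Ioo 0 1) :=
  ⟨1 - (1 / 2 - growth k (1 / 2)), forall_mem_image.2 fun _ ht => hk.growth_le hφ ht⟩

theorem koebeRadius_pos : 0 < koebeRadius k := by
  have hle : growth k (1 / 2) ≤ koebeRadius k :=
    le_csSup (hk.bddAbove_growth hφ) (mem_image_of_mem _ (by norm_num))
  have hpos : growth k 0 < growth k (1 / 2) :=
    hk.strictMonoOn_growth hφ (by norm_num) (by norm_num) (by norm_num)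
  rw [hk.1.growth_zero] at hpos
  exact hpos.trans_le hle

theorem koebeRadius_lt_one : koebeRadius k < 1 := by
  have hle := koebeRadius_le fun t ht => hk.growth_le hφ ht
  have hlt : 0 - growth k 0 < 1 / 2 - growth k (1 / 2) :=
    hk.strictMonoOn_sub_growth hφ (by norm_num) (by norm_num) (by norm_num)
  rw [hk.1.growth_zero] at hlt
  linarith

theorem tendsto_apply_neg :
    Tendsto (fun r : ℝ => k (-(r : ℂ))) (𝓝[<] 1) (𝓝 ((-koebeRadius k : ℝ) : ℂ)) := by
  have hlim : Tendsto (growth k) (𝓝[<] 1) (𝓝 (koebeRadius k)) :=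
    ((hk.strictMonoOn_growth hφ).monotoneOn.mono Ioo_subset_Ico_self).tendsto_nhdsWithin_Ioo_left
      (nonempty_Ioo.2 zero_lt_one) (hk.bddAbove_growth hφ)
  refine ((Complex.continuous_ofReal.tendsto _).comp hlim.neg).congr' ?_
  filter_upwards [Ioo_mem_nhdsLT (zero_lt_one' ℝ)] with r hr
  rw [hk.apply_neg hφ ⟨by linarith [hr.1], hr.2⟩, Function.comp_apply, Complex.ofReal_neg]

end IsConvexExtremal

namespace IsUnivalentNormalized

variable {k : ℂ → ℂ} (hk : IsUnivalentNormalized k)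
include hk

theorem le_absSum {t : ℝ} (h0 : 0 ≤ t) (h1 : t < 1) : t ≤ absSum k t := by
  simpa [coeff_one, hk.deriv_zero, absSum] using
    (summable_norm_coeff hk.analytic h0 h1).le_tsum 1 fun n _ => by positivity

theorem hasDerivAt_absSum_of_mem_Ico {t : ℝ} (ht : t ∈ Ico (0 : ℝ) 1) :
    HasDerivAt (absSum k) (absSum (deriv k) t) t :=
  hasDerivAt_absSum hk.analytic ((abs_of_nonneg ht.1).trans_lt ht.2)

theorem strictMonoOn_absSum : StrictMonoOn (absSum k) (Ico 0 1) := by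
  refine strictMonoOn_of_hasDerivWithinAt_pos (convex_Ico 0 1)
    (HasDerivAt.continuousOn fun t ht => hk.hasDerivAt_absSum_of_mem_Ico ht)
    (fun t ht => (hk.hasDerivAt_absSum_of_mem_Ico (interior_subset ht)).hasDerivWithinAt)
    fun t ht => zero_lt_one.trans_le ?_
  have ht' := interior_subset ht
  simpa [hk.deriv_zero] using
    norm_apply_zero_le_absSum (hk.analytic.deriv isOpen_disk) ht'.1 ht'.2

theorem exists_absSum_eq {c : ℝ} (hc : c ∈ Ioo (0 : ℝ) 1) :
    ∃ r ∈ Ioo (0 : ℝ) 1, absSum k r = c := by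
  obtain ⟨b, hcb, hb⟩ := exists_between hc.2
  have hb0 : 0 < b := hc.1.trans hcb
  have hcont : ContinuousOn (absSum k) (Icc 0 b) := HasDerivAt.continuousOn fun t ht =>
    hk.hasDerivAt_absSum_of_mem_Ico ⟨ht.1, ht.2.trans_lt hb⟩
  have hmem : c ∈ Ioo (absSum k 0) (absSum k b) :=
    ⟨by simpa [absSum_zero, hk.map_zero] using hc.1, hcb.trans_le (hk.le_absSum hb0.le hb)⟩
  obtain ⟨r, hr, hrc⟩ := intermediate_value_Ioo hb0.le hcont hmem
  exact ⟨r, ⟨hr.1, hr.2.trans hb⟩, hrc⟩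

end IsUnivalentNormalized

theorem IsConvexExtremal.isLeast_root {φ k : ℂ → ℂ} (hφ : IsPositiveUnivalent φ)
    (hk : IsConvexExtremal φ k) {c r : ℝ} (hr : r ∈ Ioo (0 : ℝ) 1) (hrc : absSum k r = c) :
    IsLeast {t : ℝ | t ∈ Ioo (0 : ℝ) 1 ∧ k (t : ℂ) + ((-c : ℝ) : ℂ) = 0} r := by
  have hiff {t : ℝ} (ht : t ∈ Ioo (0 : ℝ) 1) :
      k (t : ℂ) + ((-c : ℝ) : ℂ) = 0 ↔ absSum k t = absSum k r := by
    rw [hk.apply_ofReal hφ ht.1.le ht.2, hrc, Complex.ofReal_neg, ← sub_eq_add_neg, sub_eq_zero,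
      Complex.ofReal_inj]
  refine ⟨⟨hr, (hiff hr).2 rfl⟩, fun t ht => ?_⟩
  exact (hk.1.strictMonoOn_absSum.injOn (Ioo_subset_Ico_self ht.1) (Ioo_subset_Ico_self hr)
    ((hiff ht.1).1 ht.2)).ge

/-! ### The Bohr inequality -/

theorem IsConvexClass.deriv_ne_zero {φ f : ℂ → ℂ} (hf : IsConvexClass φ f)
    (hφ : DifferentiableOn ℂ φ disk) (h0 : φ 0 = 1) {z : ℂ} (hz : z ∈ disk) : deriv f z ≠ 0 := by
  obtain ⟨_, Q, -, -, -, -, hfQ⟩ := hf.exists_log_deriv hφ h0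
  rw [hfQ z hz]
  exact Complex.exp_ne_zero _

theorem IsConvexExtremal.isConvexClass {φ k : ℂ → ℂ} (hk : IsConvexExtremal φ k) :
    IsConvexClass φ k :=
  ⟨hk.1, id, differentiableOn_id, mapsTo_id disk, rfl, hk.2⟩

namespace IsConvexExtremal

variable {φ k f : ℂ → ℂ} (hφ : IsPositiveUnivalent φ) (hk : IsConvexExtremal φ k)
include hφ hk

theorem koebeRadius_le_boundaryDist (hf : IsConvexClass φ f) : koebeRadius k ≤ boundaryDist f := by
  have hneg {t : ℝ} (ht : t ∈ Ico (0 : ℝ) 1) : -t ∈ Ioo (-1 : ℝ) 1 :=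
    ⟨by linarith [ht.2], by linarith [ht.1]⟩
  refine koebeRadius_le fun t ht => ?_
  exact le_boundaryDist_of_le_norm_deriv hf.1.analytic
    (fun z hz => hf.deriv_ne_zero hφ.analytic hφ.map_zero hz) hf.1.univalent hf.1.map_zero
    (fun s hs => hk.1.hasDerivAt_growth (Ico_zero_one_subset_Ioo hs)) hk.1.growth_zero
    (fun s hs => hk.re_deriv_ofReal_pos hφ (hneg hs))
    (fun z hz => hk.re_deriv_neg_le_norm_deriv hφ hf hz) (Ioo_subset_Ico_self ht)

theorem absSum_le (hf : IsConvexClass φ f) {r : ℝ} (h0 : 0 ≤ r) (h1 : r ≤ 1 / 3) :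
    absSum f r ≤ absSum k r := by
  obtain ⟨hfS, ω, hω, hωd, hω0, hfω⟩ := hf
  have hφω : DifferentiableOn ℂ (fun z => φ (ω z)) disk := hφ.analytic.comp hω hωd
  have hr : r < 1 := by linarith
  have hmaj : ∀ t ∈ Icc 0 r, absSum (fun z => φ (ω z) - 1) t ≤ absSum (fun z => φ z - 1) t :=
    fun t ht => absSum_comp_le (s := fun z => φ z - 1) (hφ.analytic.sub_const 1) hω hωd hω0 ht.1
      (ht.2.trans_lt hr) (absSum_le_self_of_mapsTo hω hωd hω0 ht.1 (ht.2.trans h1))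
  refine absSum_le_of_absSum_deriv_le hfS.analytic hk.1.analytic
    (by rw [hfS.map_zero, hk.1.map_zero]) h0 hr fun t ht => ?_
  exact absSum_le_of_id_mul_deriv_eq (hfS.analytic.deriv isOpen_disk)
    (hk.1.analytic.deriv isOpen_disk) (hφω.sub_const 1) (hφ.analytic.sub_const 1)
    (fun z hz => hfS.id_mul_deriv_deriv_eq hφω hfω hz)
    (fun z hz => hk.1.id_mul_deriv_deriv_eq hφ.analytic hk.2 hz) hφ.coeff_sub_one_nonneg
    (by rw [hφ.map_zero, sub_self]) (by simp [hk.1.deriv_zero])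
    (by rw [hfS.deriv_zero, hk.1.deriv_zero]) hr hmaj ht

theorem majorant_le_boundaryDist (hf : IsConvexClass φ f) {r rf : ℝ} (hrf : rf < 1)
    (hrfk : absSum k rf = koebeRadius k) (h0 : 0 ≤ r) (hr : r ≤ min rf (1 / 3)) :
    majorant f r ≤ boundaryDist f := by
  obtain ⟨hr, h1⟩ := le_min_iff.1 hr
  calc majorant f r = absSum f r := hf.1.majorant_eq_absSum h0 (hr.trans_lt hrf)
    _ ≤ absSum k r := hk.absSum_le hφ hf h0 h1
    _ ≤ absSum k rf := hk.1.strictMonoOn_absSum.monotoneOn ⟨h0, hr.trans_lt hrf⟩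
        ⟨h0.trans hr, hrf⟩ hr
    _ = koebeRadius k := hrfk
    _ ≤ boundaryDist f := hk.koebeRadius_le_boundaryDist hφ hf

theorem boundaryDist_le_koebeRadius : boundaryDist k ≤ koebeRadius k := by
  have hnorm : Tendsto (fun r : ℝ => ‖-(r : ℂ)‖) (𝓝[<] 1) (𝓝 1) := by
    have hc : Continuous fun r : ℝ => ‖-(r : ℂ)‖ := by fun_prop
    simpa using (hc.tendsto 1).mono_left nhdsWithin_le_nhds
  have hdisk : ∀ᶠ r : ℝ in 𝓝[<] 1, -(r : ℂ) ∈ disk := by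
    filter_upwards [Ioo_mem_nhdsLT (neg_one_lt_zero.trans zero_lt_one)] with r hr
    simpa [mem_disk, abs_lt] using hr
  have hmem := mem_frontier_image_of_tendsto hk.1.analytic
    (fun z hz => hk.isConvexClass.deriv_ne_zero hφ.analytic hφ.map_zero hz) hk.1.univalent
    hdisk hnorm (hk.tendsto_apply_neg hφ)
  refine (Metric.infDist_le_dist_of_mem hmem).trans_eq ?_
  rw [hk.1.map_zero, dist_zero_left, Complex.norm_real, norm_neg,
    Real.norm_of_nonneg (hk.koebeRadius_pos hφ).le]

end IsConvexExtremal

/-! ### Rotations -/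

theorem norm_exp_ofReal_mul_I_mul (θ : ℝ) (z : ℂ) :
    ‖Complex.exp (θ * Complex.I) * z‖ = ‖z‖ := by
  rw [norm_mul, Complex.norm_exp_ofReal_mul_I, one_mul]

theorem mapsTo_exp_mul_disk (θ : ℝ) :
    MapsTo (fun z => Complex.exp (θ * Complex.I) * z) disk disk := fun z hz => by
  rwa [mem_disk, norm_exp_ofReal_mul_I_mul, ← mem_disk]

theorem deriv_rotation (θ : ℝ) (f : ℂ → ℂ) :
    deriv (rotation θ f) = fun z => deriv f (Complex.exp (θ * Complex.I) * z) := by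
  ext z
  unfold rotation
  rw [deriv_const_mul_field, deriv_comp_mul_left, smul_eq_mul, ← mul_assoc, ← Complex.exp_add,
    neg_add_cancel, Complex.exp_zero, one_mul]

theorem convexityQuotient_rotation (θ : ℝ) (f : ℂ → ℂ) (z : ℂ) :
    convexityQuotient (rotation θ f) z
      = convexityQuotient f (Complex.exp (θ * Complex.I) * z) := by
  rw [convexityQuotient, convexityQuotient, deriv_rotation, deriv_comp_mul_left, smul_eq_mul]
  ring

theorem IsUnivalentNormalized.rotation {f : ℂ → ℂ} (hf : IsUnivalentNormalized f) (θ : ℝ) :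
    IsUnivalentNormalized (rotation θ f) where
  analytic := (hf.analytic.comp (by fun_prop) (mapsTo_exp_mul_disk θ)).const_mul _
  map_zero := by simp [MaMinda.rotation, hf.map_zero]
  deriv_zero := by simp [deriv_rotation, hf.deriv_zero]
  univalent _ hz _ hw hzw := mul_left_cancel₀ (Complex.exp_ne_zero _) <|
    hf.univalent (mapsTo_exp_mul_disk θ hz) (mapsTo_exp_mul_disk θ hw) <|
      mul_left_cancel₀ (Complex.exp_ne_zero _) hzw

theorem IsConvexClass.rotation {φ f : ℂ → ℂ} (hf : IsConvexClass φ f) (θ : ℝ) :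
    IsConvexClass φ (rotation θ f) := by
  obtain ⟨hfS, ω, hω, hωd, hω0, hfω⟩ := hf
  have hmaps := mapsTo_exp_mul_disk θ
  refine ⟨hfS.rotation θ, fun z => ω (Complex.exp (θ * Complex.I) * z),
    hω.comp (by fun_prop) hmaps, hωd.comp hmaps, by simp only [mul_zero, hω0], fun z hz => ?_⟩
  rw [convexityQuotient_rotation, hfω _ (hmaps hz)]

theorem absSum_rotation {f : ℂ → ℂ} (hf : DifferentiableOn ℂ f disk) (θ : ℝ) :
    absSum (rotation θ f) = absSum f := by
  have hcoeff : coeff (rotation θ f) = fun n =>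
      Complex.exp (-(θ * Complex.I)) * Complex.exp (θ * Complex.I) ^ n * coeff f n :=
    coeff_eq_of_hasSum_disk fun z hz =>
      ((hasSum_coeff hf (mapsTo_exp_mul_disk θ hz)).mul_left
        (Complex.exp (-(θ * Complex.I)))).congr_fun fun n => by ring
  ext r
  refine tsum_congr fun n => ?_
  rw [hcoeff, norm_mul, norm_mul, norm_pow, Complex.norm_exp_ofReal_mul_I, ← neg_mul,
    ← Complex.ofReal_neg, Complex.norm_exp_ofReal_mul_I, one_pow, one_mul, one_mul]

theorem boundaryDist_rotation (θ : ℝ) (f : ℂ → ℂ) :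
    boundaryDist (rotation θ f) = boundaryDist f := by
  set e : ℂ ≃ₗᵢ[ℝ] ℂ := _root_.rotation (Circle.exp (-θ)) with he
  have hrot (z : ℂ) : rotation θ f z = e (f (Complex.exp (θ * Complex.I) * z)) := by
    rw [he, rotation_apply, Circle.coe_exp, Complex.ofReal_neg, neg_mul, rotation]
  have hdisk : (fun z => Complex.exp (θ * Complex.I) * z) '' disk = disk := by
    refine (mapsTo_exp_mul_disk θ).image_subset.antisymm fun z hz =>
      ⟨_, mapsTo_exp_mul_disk (-θ) hz, ?_⟩
    simp [← mul_assoc, ← Complex.exp_add]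
  have himage : rotation θ f '' disk = e '' (f '' disk) := by
    conv_rhs => rw [← hdisk, image_image, image_image]
    exact image_congr fun z _ => hrot z
  have hfrontier : frontier (rotation θ f '' disk) = e '' frontier (f '' disk) := by
    rw [himage]
    exact (e.toHomeomorph.image_frontier _).symm
  rw [boundaryDist, hfrontier, hrot, mul_zero, Metric.infDist_image e.isometry, boundaryDist]

theorem IsConvexExtremal.boundaryDist_rotation {φ k : ℂ → ℂ} (hφ : IsPositiveUnivalent φ)
    (hk : IsConvexExtremal φ k) (θ : ℝ) : boundaryDist (rotation θ k) = koebeRadius k := by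
  rw [MaMinda.boundaryDist_rotation]
  exact (hk.boundaryDist_le_koebeRadius hφ).antisymm
    (hk.koebeRadius_le_boundaryDist hφ hk.isConvexClass)

theorem IsUnivalentNormalized.majorant_rotation {f : ℂ → ℂ} (hf : IsUnivalentNormalized f) (θ : ℝ)
    {r : ℝ} (h0 : 0 ≤ r) (h1 : r < 1) : majorant (MaMinda.rotation θ f) r = absSum f r := by
  rw [(hf.rotation θ).majorant_eq_absSum h0 h1, absSum_rotation hf.analytic]

theorem IsMaMinda.isPositiveUnivalent {φ : ℂ → ℂ} (hφ : IsMaMinda φ)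
    (hB : ∀ n : ℕ, 1 ≤ n → 0 ≤ coeff φ n) : IsPositiveUnivalent φ where
  analytic := hφ.analytic
  univalent := hφ.univalent
  map_zero := hφ.map_zero
  coeff_nonneg n := n.eq_zero_or_pos.elim
    (fun hn => by rw [hn, coeff_zero, hφ.map_zero]; exact zero_le_one) (hB n)

end MaMinda

theorem theorem2p10_general (φ : ℂ → ℂ) (hφ : MaMinda.IsPositiveUnivalent φ)
    (hre : ∀ z ∈ MaMinda.disk, 0 < (φ z).re) :
    (∃ k : ℂ → ℂ, MaMinda.IsConvexExtremal φ k) ∧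
    ∀ k : ℂ → ℂ, MaMinda.IsConvexExtremal φ k →
      ∃ κ : ℝ, Tendsto (fun r : ℝ => k (-(r : ℂ))) (𝓝[<] 1) (𝓝 (κ : ℂ)) ∧
      ∃ rf : ℝ, IsLeast {r : ℝ | r ∈ Ioo (0 : ℝ) 1 ∧ k (r : ℂ) + (κ : ℂ) = 0} rf ∧
        (∀ f : ℂ → ℂ, MaMinda.IsConvexClass φ f →
          (∀ z : ℂ, ‖z‖ < 1 → Summable fun n : ℕ => ‖MaMinda.coeff f (n + 2)‖ * ‖z‖ ^ (n + 2)) ∧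
          ∀ z : ℂ, ‖z‖ ≤ min rf (1 / 3) →
            MaMinda.majorant f ‖z‖ ≤ MaMinda.boundaryDist f) ∧
        (∀ θ : ℝ,
          MaMinda.IsConvexClass φ (MaMinda.rotation θ k) ∧
          MaMinda.boundaryDist (MaMinda.rotation θ k) = -κ ∧
          MaMinda.majorant (MaMinda.rotation θ k) rf =
            MaMinda.boundaryDist (MaMinda.rotation θ k) ∧
          ∀ z : ℂ, rf < ‖z‖ → ‖z‖ < 1 →
            MaMinda.boundaryDist (MaMinda.rotation θ k) <
              MaMinda.majorant (MaMinda.rotation θ k) ‖z‖) := by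
  refine ⟨MaMinda.exists_isConvexExtremal hφ.analytic hre hφ.map_zero, fun k hk => ?_⟩
  obtain ⟨rf, hrf, hrfk⟩ :=
    hk.1.exists_absSum_eq ⟨hk.koebeRadius_pos hφ, hk.koebeRadius_lt_one hφ⟩
  refine ⟨-MaMinda.koebeRadius k, hk.tendsto_apply_neg hφ, rf, hk.isLeast_root hφ hrf hrfk,
    fun f hf => ⟨fun z hz => ?_, fun z hz => ?_⟩, fun θ => ?_⟩
  · exact (summable_nat_add_iff 2).2
      (MaMinda.summable_norm_coeff hf.1.analytic (norm_nonneg z) hz)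
  · exact hk.majorant_le_boundaryDist hφ hf hrf.2 hrfk (norm_nonneg z) hz
  · have hdist := hk.boundaryDist_rotation hφ θ
    refine ⟨hk.isConvexClass.rotation θ, by rw [hdist, neg_neg], ?_, fun z hz hz1 => ?_⟩
    · rw [hdist, hk.1.majorant_rotation θ hrf.1.le hrf.2, hrfk]
    · rw [hdist, hk.1.majorant_rotation θ (norm_nonneg z) hz1, ← hrfk]
      exact hk.1.strictMonoOn_absSum (Ioo_subset_Ico_self hrf) ⟨norm_nonneg z, hz1⟩ hz

theorem theorem2p10 (φ : ℂ → ℂ) (hφ : MaMinda.IsMaMinda φ)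
    (hB : ∀ n : ℕ, 1 ≤ n → (MaMinda.coeff φ n).im = 0 ∧ 0 < (MaMinda.coeff φ n).re)
    (hH : MaMinda.IsHardyTwo φ) :
    -- the extremal function exists
    (∃ k : ℂ → ℂ, MaMinda.IsConvexExtremal φ k) ∧
    ∀ k : ℂ → ℂ, MaMinda.IsConvexExtremal φ k →
      -- `κ` is the radial limit `k(-1)` and `rf` the smallest root of `k(r) + k(-1) = 0`
      ∃ κ : ℝ, Tendsto (fun r : ℝ => k (-(r : ℂ))) (𝓝[<] 1) (𝓝 (κ : ℂ)) ∧
      ∃ rf : ℝ, IsLeast {r : ℝ | r ∈ Ioo (0 : ℝ) 1 ∧ k (r : ℂ) + (κ : ℂ) = 0} rf ∧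
        -- the Bohr inequality for the whole class
        (∀ f : ℂ → ℂ, MaMinda.IsConvexClass φ f →
          (∀ z : ℂ, ‖z‖ < 1 → Summable fun n : ℕ => ‖MaMinda.coeff f (n + 2)‖ * ‖z‖ ^ (n + 2)) ∧
          ∀ z : ℂ, ‖z‖ ≤ min rf (1 / 3) →
            MaMinda.majorant f ‖z‖ ≤ MaMinda.boundaryDist f) ∧
        -- sharpness: equality at `rf` and failure beyond `rf` for the rotations of `k`
        (rf ≤ 1 / 3 → ∀ θ : ℝ,
          MaMinda.IsConvexClass φ (MaMinda.rotation θ k) ∧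
          MaMinda.boundaryDist (MaMinda.rotation θ k) = -κ ∧
          MaMinda.majorant (MaMinda.rotation θ k) rf =
            MaMinda.boundaryDist (MaMinda.rotation θ k) ∧
          ∀ z : ℂ, rf < ‖z‖ → ‖z‖ < 1 →
            MaMinda.boundaryDist (MaMinda.rotation θ k) <
              MaMinda.majorant (MaMinda.rotation θ k) ‖z‖) := by
  have hφ' : MaMinda.IsPositiveUnivalent φ := hφ.isPositiveUnivalent fun n hn =>
    Complex.nonneg_iff.2 ⟨(hB n hn).2.le, (hB n hn).1.symm⟩
  obtain ⟨hex, hmain⟩ := theorem2p10_general φ hφ' hφ.re_pos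
  refine ⟨hex, fun k hk => ?_⟩
  obtain ⟨κ, hκ, rf, hrf, hbohr, hsharp⟩ := hmain k hk
  exact ⟨κ, hκ, rf, hrf, hbohr, fun _ => hsharp⟩
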